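/- Let $\Bbbk$ be an algebraically closed field. A $\Bbbk$-additive category is a category whose Hom-sets are $\Bbbk$-modules with $\Bbbk$-bilinear composition and in which every finite family of objects has a direct sum. An object $i$ of such a category is simple if $\mathrm{End}(i)$ is a free $\Bbbk$-module of rank $1$. The category is split semisimple if every object is a finite direct sum of simple objects and $\mathrm{Hom}(i,j)=0$ for all non-isomorphic simple objects $i,j$; it is finite if moreover the set of isomorphism classes of simple objects is finite. A pivotal category is a monoidal category in which every object $X$ has an object $X^*$ that is both a left dual (via $\mathrm{ev}_X\colon X^*\otimes X\to\mathbb 1$, $\mathrm{coev}_X\colon\mathbb 1\to X\otimes X^*$) and a right dual (via $\widetilde{\mathrm{ev}}_X\colon X\otimes X^*\to\mathbb 1$, $\widetilde{\mathrm{coev}}_X\colon\mathbb 1\to X^*\otimes X$), such that the left and right dual functors coincide as monoidal functors. Set $\dim_l(X)=\mathrm{ev}_X\,\widetilde{\mathrm{coev}}_X$ and $\dim_r(X)=\widetilde{\mathrm{ev}}_X\,\mathrm{coev}_X$ in $\mathrm{End}(\mathbb 1)$. The dimension of a finite split semisimple pivotal category $\mathcal D$ is $\dim(\mathcal D)=\sum_{i\in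 I}\dim_l(i)\dim_r(i)\in\mathrm{End}_{\mathcal D}(\mathbb 1)$, where $I$ is a set of representatives of the isomorphism classes of simple objects of $\mathcal D$. Let $\mathcal C$ be a $\Bbbk$-additive pivotal category (with $\Bbbk$-bilinear monoidal product) which is split semisimple and whose unit object $\mathbb 1$ is simple. Let $\mathcal D$ be a (not necessarily full) $\Bbbk$-linear pivotal subcategory of $\mathcal C$, that is, a $\Bbbk$-linear monoidal subcategory stable under duality and containing the morphisms $\mathrm{ev}_X,\mathrm{coev}_X,\widetilde{\mathrm{ev}}_X,\widetilde{\mathrm{coev}}_X$ for all $X\in\mathcal D$. Suppose that $\mathcal D$ is finite split semisimple and $\dim(\mathcal D)\neq 0$. Let $\mathcal Z(\mathcal C;\mathcal D)$ be the relative center: its objects are the pairs $(A,\sigma)$, where $A\in\mathcal C$ and $\sigma=\{\sigma_X\colon A\otimes X\to X\otimes A\}_{X\in\mathcal D}$ is a family of isomorphisms in $\mathcal C$, natural with respect to the morphisms of $\mathcal D$, such that $\sigma_{X\otimes Y}=(\mathrm{id}_X\otimes\sigma_Y)(\sigma_X\otimes\mathrm{id}_Y)$ (up to associativity constraints) for all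 $X,Y\in\mathcal D$; a morphism $(A,\sigma)\to(A',\sigma')$ is a morphism $f\colon A\to A'$ of $\mathcal C$ such that $(\mathrm{id}_X\otimes f)\sigma_X=\sigma'_X(f\otimes\mathrm{id}_X)$ for all $X\in\mathcal D$. Then $\mathcal Z(\mathcal C;\mathcal D)$ is a $\Bbbk$-additive split semisimple category. -/

import Mathlib

open CategoryTheory CategoryTheory.Limits MonoidalCategory

universe w v u

/-- A pivotal category: every object `X` has a dual object `dual X` which is at the same time
a left dual (with `ev X : dual X ⊗ X ⟶ 𝟙_ C` and `coev X : 𝟙_ C ⟶ X ⊗ dual X`) and a right dual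
(with `evR X : X ⊗ dual X ⟶ 𝟙_ C` and `coevR X : 𝟙_ C ⟶ dual X ⊗ X`), such that the left and the
right dual functors are equal as monoidal functors: on morphisms (`dual_map`) and in their
monoidal constraints (`dual_unit` and `dual_tensor`). -/
class PivotalCategory (C : Type u) [Category.{v} C] [MonoidalCategory C] where
  /-- the dual object -/
  dual : C → C
  /-- `dual X` is a left dual of `X` -/
  leftPairing : ∀ X : C, ExactPairing X (dual X)
  /-- `dual X` is a right dual of `X` -/
  rightPairing : ∀ X : C, ExactPairing (dual X) X
  dual_map : ∀ {X Y : C} (f : X ⟶ Y),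
    (ρ_ (dual Y)).inv ≫ dual Y ◁ (leftPairing X).coevaluation' ≫
        dual Y ◁ f ▷ dual X ≫ (α_ (dual Y) Y (dual X)).inv ≫
        (leftPairing Y).evaluation' ▷ dual X ≫ (λ_ (dual X)).hom =
      (λ_ (dual Y)).inv ≫ (rightPairing X).coevaluation' ▷ dual Y ≫
        (dual X ◁ f) ▷ dual Y ≫ (α_ (dual X) Y (dual Y)).hom ≫
        dual X ◁ (rightPairing Y).evaluation' ≫ (ρ_ (dual X)).hom
  dual_unit :
    (leftPairing (𝟙_ C)).coevaluation' ≫ (λ_ (dual (𝟙_ C))).hom =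
      (rightPairing (𝟙_ C)).coevaluation' ≫ (ρ_ (dual (𝟙_ C))).hom
  dual_tensor : ∀ X Y : C,
    (𝟙 (dual X ⊗ dual Y) ⊗≫
      (dual X ⊗ dual Y) ◁ (leftPairing (Y ⊗ X)).coevaluation' ⊗≫
      dual X ◁ (leftPairing Y).evaluation' ▷ (X ⊗ dual (Y ⊗ X)) ⊗≫
      (leftPairing X).evaluation' ▷ dual (Y ⊗ X) ⊗≫
      𝟙 (dual (Y ⊗ X))) =
    (𝟙 (dual X ⊗ dual Y) ⊗≫
      (rightPairing (Y ⊗ X)).coevaluation' ▷ (dual X ⊗ dual Y) ⊗≫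
      (dual (Y ⊗ X) ⊗ Y) ◁ (rightPairing X).evaluation' ▷ dual Y ⊗≫
      dual (Y ⊗ X) ◁ (rightPairing Y).evaluation' ⊗≫
      𝟙 (dual (Y ⊗ X)))

namespace PivotalCategory

section

variable {C : Type u} [Category.{v} C] [MonoidalCategory C] [PivotalCategory C]

/-- The left evaluation. -/
def ev (X : C) : dual X ⊗ X ⟶ 𝟙_ C := (leftPairing X).evaluation'

/-- The left coevaluation. -/
def coev (X : C) : 𝟙_ C ⟶ X ⊗ dual X := (leftPairing X).coevaluation'

/-- The right evaluation. -/
def evR (X : C) : X ⊗ dual X ⟶ 𝟙_ C := (rightPairing X).evaluation'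

/-- The right coevaluation. -/
def coevR (X : C) : 𝟙_ C ⟶ dual X ⊗ X := (rightPairing X).coevaluation'

/-- The left trace of an endomorphism. -/
def trL {X : C} (g : X ⟶ X) : End (𝟙_ C) := coevR X ≫ dual X ◁ g ≫ ev X

/-- The right trace of an endomorphism. -/
def trR {X : C} (g : X ⟶ X) : End (𝟙_ C) := coev X ≫ g ▷ dual X ≫ evR X

/-- The left dimension of an object. -/
def dimL (X : C) : End (𝟙_ C) := trL (𝟙 X)

/-- The right dimension of an object. -/
def dimR (X : C) : End (𝟙_ C) := trR (𝟙 X)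

end

end PivotalCategory

section SplitSemisimple

variable (k : Type w) [CommRing k] {C : Type u} [Category.{v} C] [Preadditive C] [Linear k C]

/-- An object `X` of a `k`-linear category is simple (in the split sense) if `End X` is a free
`k`-module of rank one. -/
def IsSplitSimple (X : C) : Prop :=
  Module.Free k (X ⟶ X) ∧ Module.rank k (X ⟶ X) = 1

variable (C)

/-- A `k`-linear category is split semisimple if it has finite direct sums, every object is a
finite direct sum of simple objects, and all morphisms between non-isomorphic simple objects
vanish. -/
structure IsSplitSemisimple : Prop where
  hasFiniteBiproducts : HasFiniteBiproducts C
  exists_decomposition : ∀ X : C, ∃ (n : ℕ) (S : Fin n → C),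
    (∀ a, IsSplitSimple k (S a)) ∧ ∃ b : Bicone S, Nonempty b.IsBilimit ∧ Nonempty (X ≅ b.pt)
  hom_eq_zero : ∀ X Y : C, IsSplitSimple k X → IsSplitSimple k Y → IsEmpty (X ≅ Y) →
    ∀ f : X ⟶ Y, f = 0

/-- The isomorphism classes of simple objects; the elements `c.1.out` form a representative set
of simple objects. -/
def SimpleClasses : Type u :=
  {c : Quotient (isIsomorphicSetoid C) // IsSplitSimple k c.out}

/-- The dimension of a pivotal category with finitely many isomorphism classes of simple objects:
the sum of `dimL i * dimR i`, where `i` runs over a representative set of simple objects. -/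
noncomputable def pivotalDim [MonoidalCategory C] [PivotalCategory C] : End (𝟙_ C) :=
  ∑ᶠ c : SimpleClasses k C, PivotalCategory.dimL c.1.out * PivotalCategory.dimR c.1.out

end SplitSemisimple

open PivotalCategory in
/-- A (not necessarily full) `k`-linear pivotal subcategory of a `k`-linear pivotal category `C`:
a class of objects and, for all objects `X`, `Y` of this class, a submodule of `X ⟶ Y`, which
contain the identities and are stable under composition, tensor product and duality and
contain the structural morphisms of the pivotal category `C`. The values of `hom` at objects
outside the class `obj` are irrelevant. -/
structure LinearPivotalSubcategory (k : Type w) [CommRing k] (C : Type u) [Category.{v} C]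
    [Preadditive C] [Linear k C] [MonoidalCategory C] [PivotalCategory C] where
  /-- the objects of the subcategory -/
  obj : C → Prop
  /-- the morphisms of the subcategory -/
  hom : ∀ X Y : C, Submodule k (X ⟶ Y)
  id_mem : ∀ {X : C}, obj X → 𝟙 X ∈ hom X X
  comp_mem : ∀ {X Y Z : C}, obj X → obj Y → obj Z → ∀ {f : X ⟶ Y} {g : Y ⟶ Z},
    f ∈ hom X Y → g ∈ hom Y Z → f ≫ g ∈ hom X Z
  unit_obj : obj (𝟙_ C)
  tensor_obj : ∀ {X Y : C}, obj X → obj Y → obj (X ⊗ Y)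
  tensor_mem : ∀ {X Y X' Y' : C}, obj X → obj Y → obj X' → obj Y' →
    ∀ {f : X ⟶ Y} {g : X' ⟶ Y'}, f ∈ hom X Y → g ∈ hom X' Y' →
      f ⊗ₘ g ∈ hom (X ⊗ X') (Y ⊗ Y')
  associator_hom_mem : ∀ {X Y Z : C}, obj X → obj Y → obj Z →
    (α_ X Y Z).hom ∈ hom ((X ⊗ Y) ⊗ Z) (X ⊗ Y ⊗ Z)
  associator_inv_mem : ∀ {X Y Z : C}, obj X → obj Y → obj Z →
    (α_ X Y Z).inv ∈ hom (X ⊗ Y ⊗ Z) ((X ⊗ Y) ⊗ Z)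
  leftUnitor_hom_mem : ∀ {X : C}, obj X → (λ_ X).hom ∈ hom (𝟙_ C ⊗ X) X
  leftUnitor_inv_mem : ∀ {X : C}, obj X → (λ_ X).inv ∈ hom X (𝟙_ C ⊗ X)
  rightUnitor_hom_mem : ∀ {X : C}, obj X → (ρ_ X).hom ∈ hom (X ⊗ 𝟙_ C) X
  rightUnitor_inv_mem : ∀ {X : C}, obj X → (ρ_ X).inv ∈ hom X (X ⊗ 𝟙_ C)
  dual_obj : ∀ {X : C}, obj X → obj (dual X)
  ev_mem : ∀ {X : C}, obj X → ev X ∈ hom (dual X ⊗ X) (𝟙_ C)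
  coev_mem : ∀ {X : C}, obj X → coev X ∈ hom (𝟙_ C) (X ⊗ dual X)
  evR_mem : ∀ {X : C}, obj X → evR X ∈ hom (X ⊗ dual X) (𝟙_ C)
  coevR_mem : ∀ {X : C}, obj X → coevR X ∈ hom (𝟙_ C) (dual X ⊗ X)

namespace LinearPivotalSubcategory

variable {k : Type w} [CommRing k] {C : Type u} [Category.{v} C] [Preadditive C] [Linear k C]
  [MonoidalCategory C] [PivotalCategory C] (D : LinearPivotalSubcategory k C)

/-- The objects of the subcategory. -/
structure Obj where
  /-- the underlying object -/
  val : C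
  property : D.obj val

instance : Category.{v} D.Obj where
  Hom X Y := D.hom X.val Y.val
  id X := ⟨𝟙 X.val, D.id_mem X.property⟩
  comp {X Y Z} f g := ⟨f.1 ≫ g.1, D.comp_mem X.property Y.property Z.property f.2 g.2⟩
  id_comp f := Subtype.ext (Category.id_comp f.1)
  comp_id f := Subtype.ext (Category.comp_id f.1)
  assoc f g h := Subtype.ext (Category.assoc f.1 g.1 h.1)

instance : Preadditive D.Obj where
  homGroup X Y := inferInstanceAs (AddCommGroup (D.hom X.val Y.val))
  add_comp _ _ _ f f' g := Subtype.ext (Preadditive.add_comp _ _ _ f.1 f'.1 g.1)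
  comp_add _ _ _ f g g' := Subtype.ext (Preadditive.comp_add _ _ _ f.1 g.1 g'.1)

instance : Linear k D.Obj where
  homModule X Y := inferInstanceAs (Module k (D.hom X.val Y.val))
  smul_comp _ _ _ r f g := Subtype.ext (Linear.smul_comp _ _ _ r f.1 g.1)
  comp_smul _ _ _ f r g := Subtype.ext (Linear.comp_smul _ _ _ f.1 r g.1)

/-- An isomorphism of `C` belonging to `D` together with its inverse. -/
def isoMk {X Y : D.Obj} (e : X.val ≅ Y.val) (h : e.hom ∈ D.hom X.val Y.val)
    (h' : e.inv ∈ D.hom Y.val X.val) : X ≅ Y where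
  hom := ⟨e.hom, h⟩
  inv := ⟨e.inv, h'⟩
  hom_inv_id := Subtype.ext e.hom_inv_id
  inv_hom_id := Subtype.ext e.inv_hom_id

theorem whiskerLeft_mem {X Y Z : C} (hX : D.obj X) (hY : D.obj Y) (hZ : D.obj Z) {f : Y ⟶ Z}
    (hf : f ∈ D.hom Y Z) : X ◁ f ∈ D.hom (X ⊗ Y) (X ⊗ Z) := by
  rw [← id_tensorHom]
  exact D.tensor_mem hX hX hY hZ (D.id_mem hX) hf

theorem whiskerRight_mem {X Y Z : C} (hX : D.obj X) (hY : D.obj Y) (hZ : D.obj Z) {f : Y ⟶ Z}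
    (hf : f ∈ D.hom Y Z) : f ▷ X ∈ D.hom (Y ⊗ X) (Z ⊗ X) := by
  rw [← tensorHom_id]
  exact D.tensor_mem hY hZ hX hX hf (D.id_mem hX)

instance : MonoidalCategory D.Obj where
  tensorObj X Y := ⟨X.val ⊗ Y.val, D.tensor_obj X.property Y.property⟩
  whiskerLeft X Y Z f := ⟨X.val ◁ f.1, D.whiskerLeft_mem X.property Y.property Z.property f.2⟩
  whiskerRight {Y Z} f X :=
    ⟨f.1 ▷ X.val, D.whiskerRight_mem X.property Y.property Z.property f.2⟩
  tensorHom {X Y X' Y'} f g := ⟨f.1 ⊗ₘ g.1,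
    D.tensor_mem X.property Y.property X'.property Y'.property f.2 g.2⟩
  tensorUnit := ⟨𝟙_ C, D.unit_obj⟩
  associator X Y Z := D.isoMk (α_ X.val Y.val Z.val)
    (D.associator_hom_mem X.property Y.property Z.property)
    (D.associator_inv_mem X.property Y.property Z.property)
  leftUnitor X := D.isoMk (λ_ X.val)
    (D.leftUnitor_hom_mem X.property) (D.leftUnitor_inv_mem X.property)
  rightUnitor X := D.isoMk (ρ_ X.val)
    (D.rightUnitor_hom_mem X.property) (D.rightUnitor_inv_mem X.property)
  tensorHom_def f g := Subtype.ext (MonoidalCategory.tensorHom_def f.1 g.1)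
  id_tensorHom_id X Y := Subtype.ext (MonoidalCategory.id_tensorHom_id X.val Y.val)
  tensorHom_comp_tensorHom f g h l :=
    Subtype.ext (MonoidalCategory.tensorHom_comp_tensorHom f.1 g.1 h.1 l.1)
  whiskerLeft_id X Y := Subtype.ext (MonoidalCategory.whiskerLeft_id X.val Y.val)
  id_whiskerRight X Y := Subtype.ext (MonoidalCategory.id_whiskerRight X.val Y.val)
  associator_naturality f g h :=
    Subtype.ext (MonoidalCategory.associator_naturality f.1 g.1 h.1)
  leftUnitor_naturality f := Subtype.ext (MonoidalCategory.leftUnitor_naturality f.1)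
  rightUnitor_naturality f := Subtype.ext (MonoidalCategory.rightUnitor_naturality f.1)
  pentagon W X Y Z := Subtype.ext (MonoidalCategory.pentagon W.val X.val Y.val Z.val)
  triangle X Y := Subtype.ext (MonoidalCategory.triangle X.val Y.val)

instance : PivotalCategory D.Obj where
  dual X := ⟨PivotalCategory.dual X.val, D.dual_obj X.property⟩
  leftPairing X :=
    { coevaluation' := ⟨PivotalCategory.coev X.val, D.coev_mem X.property⟩
      evaluation' := ⟨PivotalCategory.ev X.val, D.ev_mem X.property⟩
      coevaluation_evaluation' :=
        Subtype.ext (PivotalCategory.leftPairing X.val).coevaluation_evaluation'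
      evaluation_coevaluation' :=
        Subtype.ext (PivotalCategory.leftPairing X.val).evaluation_coevaluation' }
  rightPairing X :=
    { coevaluation' := ⟨PivotalCategory.coevR X.val, D.coevR_mem X.property⟩
      evaluation' := ⟨PivotalCategory.evR X.val, D.evR_mem X.property⟩
      coevaluation_evaluation' :=
        Subtype.ext (PivotalCategory.rightPairing X.val).coevaluation_evaluation'
      evaluation_coevaluation' :=
        Subtype.ext (PivotalCategory.rightPairing X.val).evaluation_coevaluation' }
  dual_map f := Subtype.ext (PivotalCategory.dual_map f.1)
  dual_unit := Subtype.ext PivotalCategory.dual_unit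
  dual_tensor X Y := Subtype.ext (PivotalCategory.dual_tensor X.val Y.val)

end LinearPivotalSubcategory

/-- The (left) center of `C` relative to `D`: its objects are the half braidings of `C` relative
to `D`, that is, the objects `A` of `C` endowed with isomorphisms `A ⊗ X ≅ X ⊗ A` for `X` in `D`
which are natural with respect to the morphisms of `D` and multiplicative in `X`. -/
structure RelativeCenter {k : Type w} [CommRing k] {C : Type u} [Category.{v} C] [Preadditive C]
    [Linear k C] [MonoidalCategory C] [PivotalCategory C] (D : LinearPivotalSubcategory k C) where
  /-- the underlying object of `C` -/
  obj : C
  /-- the half braiding -/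
  σ : ∀ X : D.Obj, obj ⊗ X.val ≅ X.val ⊗ obj
  naturality : ∀ {X Y : D.Obj} (f : X ⟶ Y),
    obj ◁ f.1 ≫ (σ Y).hom = (σ X).hom ≫ f.1 ▷ obj
  monoidal : ∀ X Y : D.Obj, (σ (X ⊗ Y)).hom =
    (α_ obj X.val Y.val).inv ≫ (σ X).hom ▷ Y.val ≫ (α_ X.val obj Y.val).hom ≫
      X.val ◁ (σ Y).hom ≫ (α_ X.val Y.val obj).inv

namespace RelativeCenter

variable {k : Type w} [CommRing k] {C : Type u} [Category.{v} C] [Preadditive C] [Linear k C]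
  [MonoidalCategory C] [PivotalCategory C] {D : LinearPivotalSubcategory k C}

/-- A morphism of half braidings. -/
@[ext]
structure Hom (A B : RelativeCenter D) where
  /-- the underlying morphism of `C` -/
  f : A.obj ⟶ B.obj
  comm : ∀ X : D.Obj, (A.σ X).hom ≫ X.val ◁ f = f ▷ X.val ≫ (B.σ X).hom

instance : Category.{v} (RelativeCenter D) where
  Hom A B := Hom A B
  id A := ⟨𝟙 A.obj, fun X => by simp⟩
  comp f g := ⟨f.f ≫ g.f, fun X => by
    rw [MonoidalCategory.whiskerLeft_comp, ← Category.assoc, f.comm, Category.assoc, g.comm,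
      comp_whiskerRight, Category.assoc]⟩
  id_comp f := Hom.ext (Category.id_comp f.f)
  comp_id f := Hom.ext (Category.comp_id f.f)
  assoc f g h := Hom.ext (Category.assoc f.f g.f h.f)

variable [MonoidalPreadditive C] [MonoidalLinear k C]

/-- The morphisms of half braidings form a submodule of the morphisms of `C`. -/
def homSubmodule (A B : RelativeCenter D) : Submodule k (A.obj ⟶ B.obj) where
  carrier := {f | ∀ X : D.Obj, (A.σ X).hom ≫ X.val ◁ f = f ▷ X.val ≫ (B.σ X).hom}
  add_mem' {f g} hf hg X := by simp [hf X, hg X]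
  zero_mem' X := by simp
  smul_mem' r f hf X := by simp [hf X]

/-- Morphisms of half braidings as elements of a submodule. -/
def homEquiv (A B : RelativeCenter D) : (A ⟶ B) ≃ homSubmodule A B where
  toFun f := ⟨f.f, f.comm⟩
  invFun f := ⟨f.1, f.2⟩
  left_inv _ := rfl
  right_inv _ := rfl

/-- Addition and scalar multiplication of morphisms are those of `C`. -/
instance : Preadditive (RelativeCenter D) where
  homGroup A B := (homEquiv A B).addCommGroup
  add_comp _ _ _ f f' g := Hom.ext (Preadditive.add_comp _ _ _ f.f f'.f g.f)
  comp_add _ _ _ f g g' := Hom.ext (Preadditive.comp_add _ _ _ f.f g.f g'.f)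

instance : Linear k (RelativeCenter D) where
  homModule A B := (homEquiv A B).module k
  smul_comp _ _ _ r f g := Hom.ext (Linear.smul_comp _ _ _ r f.f g.f)
  comp_smul _ _ _ f r g := Hom.ext (Linear.comp_smul _ _ _ f.f r g.f)

end RelativeCenter

/-!
A morphism of `Z(C;D)` has a pseudo-inverse in the split semisimple category `C`. Conjugate that
pseudo-inverse by the half braidings at the simple objects of `D`, take right partial traces, and
sum with the left dimensions as weights. This averaging takes every morphism of `C` between objects
of `Z(C;D)` to a morphism of `Z(C;D)`, commutes with composition by morphisms of `Z(C;D)` on either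
side, and multiplies those by `dim D`. As `dim D` is invertible, it turns the pseudo-inverse in `C`
into a pseudo-inverse in `Z(C;D)`, up to a scalar: the category `Z(C;D)` is von Neumann regular.
It also has split idempotents and finite-dimensional morphism spaces, so over an algebraically
closed field an object whose endomorphisms are not all scalars splits off a proper summand.
-/

/-! ### Split semisimple linear categories -/

section CommRing

variable {k : Type w} [CommRing k] {C : Type u} [Category.{v} C] [Preadditive C] [Linear k C]

theorem isSplitSimple_iff_bijective {X : C} :
    IsSplitSimple k X ↔ Function.Bijective fun c : k => c • 𝟙 X := by
  cases subsingleton_or_nontrivial k with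
  | inl _ =>
    have : Subsingleton (X ⟶ X) := Module.subsingleton k _
    exact ⟨fun _ => ⟨Function.injective_of_subsingleton _, fun f => ⟨0, Subsingleton.elim _ f⟩⟩,
      fun _ => ⟨Module.Free.of_subsingleton k _, rank_subsingleton k _⟩⟩
  | inr _ =>
    constructor
    · rintro ⟨_, hrank⟩
      obtain ⟨e⟩ := Module.nonempty_linearEquiv_iff_rank_eq_one.2 hrank
      exact bijective_algebraMap_of_linearEquiv (E := End X) e
    · intro h
      let e : k ≃ₗ[k] (X ⟶ X) :=
        LinearEquiv.ofBijective (LinearMap.toSpanSingleton k (X ⟶ X) (𝟙 X)) h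
      have := Module.Free.of_equiv e
      exact ⟨this, Module.nonempty_linearEquiv_iff_rank_eq_one.1 ⟨e⟩⟩

namespace IsSplitSimple

theorem smul_id_injective {X : C} (hX : IsSplitSimple k X) :
    Function.Injective fun c : k => c • 𝟙 X :=
  (isSplitSimple_iff_bijective.1 hX).injective

theorem id_ne_zero [Nontrivial k] {X : C} (hX : IsSplitSimple k X) : 𝟙 X ≠ 0 := fun h =>
  one_ne_zero (hX.smul_id_injective (by simp [h] : (1 : k) • 𝟙 X = (0 : k) • 𝟙 X))

theorem exists_eq_smul_id {X : C} (hX : IsSplitSimple k X) (f : X ⟶ X) :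
    ∃ c : k, f = c • 𝟙 X :=
  ((isSplitSimple_iff_bijective.1 hX).surjective f).imp fun _ h => h.symm

theorem of_iso {X Y : C} (hX : IsSplitSimple k X) (e : X ≅ Y) : IsSplitSimple k Y := by
  let φ : (X ⟶ X) ≃ₗ[k] (Y ⟶ Y) := Linear.homCongr k e e
  have := hX.1
  exact ⟨Module.Free.of_equiv φ, φ.rank_eq.symm.trans hX.2⟩

theorem finite_end {X : C} (hX : IsSplitSimple k X) : Module.Finite k (X ⟶ X) :=
  Module.Finite.of_surjective (LinearMap.toSpanSingleton k (X ⟶ X) (𝟙 X))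
    (isSplitSimple_iff_bijective.1 hX).surjective

end IsSplitSimple

variable (k) in
/-- A decomposition of the object `X` as a finite direct sum of simple objects, given by the
inclusions and projections of the summands. -/
structure SimpleDecomposition (X : C) where
  J : Type
  [fintype : Fintype J]
  S : J → C
  simple : ∀ a, IsSplitSimple k (S a)
  ι : ∀ a, S a ⟶ X
  π : ∀ a, X ⟶ S a
  ι_π_self : ∀ a, ι a ≫ π a = 𝟙 (S a)
  ι_π_ne : ∀ a b, a ≠ b → ι a ≫ π b = 0
  total : ∑ a, π a ≫ ι a = 𝟙 X

attribute [instance] SimpleDecomposition.fintype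
attribute [simp] SimpleDecomposition.ι_π_self

theorem IsSplitSemisimple.nonempty_simpleDecomposition (hC : IsSplitSemisimple k C) (X : C) :
    Nonempty (SimpleDecomposition k X) := by
  obtain ⟨n, S, hS, b, ⟨hb⟩, ⟨e⟩⟩ := hC.exists_decomposition X
  exact ⟨{
    J := Fin n
    S := S
    simple := hS
    ι := fun a => b.ι a ≫ e.inv
    π := fun a => e.hom ≫ b.π a
    ι_π_self := fun a => by simp
    ι_π_ne := fun a a' h => by simp [bicone_ι_π_ne b h]
    total := by
      calc ∑ a, (e.hom ≫ b.π a) ≫ b.ι a ≫ e.inv = e.hom ≫ (∑ a, b.π a ≫ b.ι a) ≫ e.inv := by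
            simp [Preadditive.sum_comp, Preadditive.comp_sum]
        _ = 𝟙 X := by simp [IsBilimit.total hb] }⟩

theorem retract_i_comp_r_eq_zero {X Y Z : C} (s : Retract Y X) (t : Retract Z X)
    (total : s.r ≫ s.i + t.r ≫ t.i = 𝟙 X) : s.i ≫ t.r = 0 := by
  have h : s.i ≫ t.r + s.i ≫ t.r = s.i ≫ t.r := by
    simpa using s.i ≫= total =≫ t.r
  simpa using h

namespace SimpleDecomposition

/-- The bicone of a decomposition, reindexed by `Fin n`. -/
noncomputable def bicone {X : C} (d : SimpleDecomposition k X) :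
    Bicone (fun a : Fin (Fintype.card d.J) => d.S ((Fintype.equivFin d.J).symm a)) where
  pt := X
  π a := d.π _
  ι a := d.ι _
  ι_π a b := by
    split_ifs with h
    · subst h
      simp
    · exact d.ι_π_ne _ _ fun h' => h ((Fintype.equivFin d.J).symm.injective h')

theorem exists_bicone {X : C} (d : SimpleDecomposition k X) :
    ∃ (n : ℕ) (S : Fin n → C), (∀ a, IsSplitSimple k (S a)) ∧
      ∃ b : Bicone S, Nonempty b.IsBilimit ∧ Nonempty (X ≅ b.pt) := by
  refine ⟨_, _, fun a => d.simple _, d.bicone, ⟨isBilimitOfTotal _ ?_⟩, ⟨Iso.refl X⟩⟩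
  exact (Equiv.sum_comp (Fintype.equivFin d.J).symm fun a => d.π a ≫ d.ι a).trans d.total

/-- The empty decomposition of a zero object. -/
def ofIdEqZero {X : C} (h : 𝟙 X = 0) : SimpleDecomposition k X where
  J := Empty
  S := Empty.elim
  simple a := a.elim
  ι a := a.elim
  π a := a.elim
  ι_π_self a := a.elim
  ι_π_ne a := a.elim
  total := by simp [h]

/-- The decomposition of a simple object with a single summand. -/
def ofIsSplitSimple {X : C} (h : IsSplitSimple k X) : SimpleDecomposition k X where
  J := Unit
  S _ := X
  simple _ := h
  ι _ := 𝟙 X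
  π _ := 𝟙 X
  ι_π_self _ := Category.comp_id _
  ι_π_ne _ _ hab := (hab rfl).elim
  total := by simp

/-- The decomposition of an object which is the direct sum of two decomposed retracts. -/
def ofRetracts {X X₁ X₂ : C} (s : Retract X₁ X) (t : Retract X₂ X)
    (total : s.r ≫ s.i + t.r ≫ t.i = 𝟙 X) (d₁ : SimpleDecomposition k X₁)
    (d₂ : SimpleDecomposition k X₂) : SimpleDecomposition k X where
  J := d₁.J ⊕ d₂.J
  S := Sum.elim d₁.S d₂.S
  simple := Sum.rec d₁.simple d₂.simple
  ι := Sum.rec (fun a => d₁.ι a ≫ s.i) (fun a => d₂.ι a ≫ t.i)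
  π := Sum.rec (fun a => s.r ≫ d₁.π a) (fun a => t.r ≫ d₂.π a)
  ι_π_self := by rintro (a | a) <;> simp
  ι_π_ne := by
    have hst := retract_i_comp_r_eq_zero s t total
    have hts := retract_i_comp_r_eq_zero t s ((add_comm _ _).trans total)
    rintro (a | a) (b | b) hab
    · have : d₁.ι a ≫ d₁.π b = 0 := d₁.ι_π_ne a b fun h => hab (congrArg _ h)
      exact (by simpa using this : (d₁.ι a ≫ s.i) ≫ s.r ≫ d₁.π b = 0)
    · exact (by simp [reassoc_of% hst] : (d₁.ι a ≫ s.i) ≫ t.r ≫ d₂.π b = 0)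
    · exact (by simp [reassoc_of% hts] : (d₂.ι a ≫ t.i) ≫ s.r ≫ d₁.π b = 0)
    · have : d₂.ι a ≫ d₂.π b = 0 := d₂.ι_π_ne a b fun h => hab (congrArg _ h)
      exact (by simpa using this : (d₂.ι a ≫ t.i) ≫ t.r ≫ d₂.π b = 0)
  total := by
    rw [Fintype.sum_sum_type]
    calc _ = s.r ≫ (∑ a, d₁.π a ≫ d₁.ι a) ≫ s.i + t.r ≫ (∑ a, d₂.π a ≫ d₂.ι a) ≫ t.i := by
          simp [Preadditive.sum_comp, Preadditive.comp_sum]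
      _ = 𝟙 X := by simp [d₁.total, d₂.total, total]

theorem exists_ι_comp_ne_zero {A B : C} (d : SimpleDecomposition k A) {f : A ⟶ B} (hf : f ≠ 0) :
    ∃ a, d.ι a ≫ f ≠ 0 := by
  contrapose! hf
  rw [← Category.id_comp f, ← d.total, Preadditive.sum_comp]
  simp [hf]

theorem exists_comp_π_ne_zero {A B : C} (d : SimpleDecomposition k B) {f : A ⟶ B} (hf : f ≠ 0) :
    ∃ a, f ≫ d.π a ≠ 0 := by
  contrapose! hf
  rw [← Category.comp_id f, ← d.total, Preadditive.comp_sum]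
  simp [reassoc_of% hf]

end SimpleDecomposition

namespace IsSplitSemisimple

theorem finite_hom_of_isSplitSimple (hC : IsSplitSemisimple k C) {X Y : C}
    (hX : IsSplitSimple k X) (hY : IsSplitSimple k Y) : Module.Finite k (X ⟶ Y) := by
  by_cases h : Nonempty (X ≅ Y)
  · have := hX.finite_end
    exact Module.Finite.equiv (Linear.homCongr k (Iso.refl X) h.some)
  · have := hC.hom_eq_zero X Y hX hY (not_nonempty_iff.1 h)
    have : Subsingleton (X ⟶ Y) := subsingleton_of_forall_eq 0 this
    infer_instance

theorem finite_hom (hC : IsSplitSemisimple k C) (A B : C) : Module.Finite k (A ⟶ B) := by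
  obtain ⟨d⟩ := hC.nonempty_simpleDecomposition A
  obtain ⟨d'⟩ := hC.nonempty_simpleDecomposition B
  have (a : d.J) (b : d'.J) : Module.Finite k (d.S a ⟶ d'.S b) :=
    hC.finite_hom_of_isSplitSimple (d.simple a) (d'.simple b)
  let φ : (∀ a b, d.S a ⟶ d'.S b) →ₗ[k] (A ⟶ B) :=
    { toFun := fun f => ∑ a, ∑ b, d.π a ≫ f a b ≫ d'.ι b
      map_add' := fun f g => by simp [Finset.sum_add_distrib]
      map_smul' := fun c f => by simp [Finset.smul_sum] }
  refine Module.Finite.of_surjective φ fun f => ⟨fun a b => d.ι a ≫ f ≫ d'.π b, ?_⟩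
  calc ∑ a, ∑ b, d.π a ≫ (d.ι a ≫ f ≫ d'.π b) ≫ d'.ι b
      = (∑ a, d.π a ≫ d.ι a) ≫ f ≫ ∑ b, d'.π b ≫ d'.ι b := by
        simp only [Preadditive.sum_comp, Preadditive.comp_sum, Category.assoc]
        exact Finset.sum_comm
    _ = f := by rw [d.total, d'.total, Category.id_comp, Category.comp_id]

end IsSplitSemisimple

end CommRing

section SplitImage

variable {C : Type u} [Category.{v} C]

variable (C) in
/-- A category is von Neumann regular if each of its morphisms has a pseudo-inverse. -/
def IsVonNeumannRegular : Prop :=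
  ∀ ⦃A B : C⦄ (f : A ⟶ B), ∃ g : B ⟶ A, f ≫ g ≫ f = f

/-- A morphism has a split image if it factors as a split epimorphism followed by a split
monomorphism. -/
def HasSplitImage {A B : C} (f : A ⟶ B) : Prop :=
  ∃ (Y : C) (p : A ⟶ Y) (i : Y ⟶ B), IsSplitEpi p ∧ IsSplitMono i ∧ p ≫ i = f

theorem isVonNeumannRegular_of_hasSplitImage
    (h : ∀ ⦃A B : C⦄ (f : A ⟶ B), HasSplitImage f) : IsVonNeumannRegular C := by
  intro A B f
  obtain ⟨Y, p, i, _, _, rfl⟩ := h f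
  exact ⟨retraction i ≫ section_ p, by simp⟩

theorem isIdempotentComplete_of_hasSplitImage
    (h : ∀ ⦃A B : C⦄ (f : A ⟶ B), HasSplitImage f) : IsIdempotentComplete C := by
  refine ⟨fun A e he => ?_⟩
  obtain ⟨Y, p, i, _, _, rfl⟩ := h e
  have hip : i ≫ p = 𝟙 Y := by
    rw [← cancel_epi p, ← cancel_mono i]
    simpa using he
  exact ⟨Y, i, p, hip, rfl⟩

variable [Preadditive C]

theorem hasSplitImage_zero [HasZeroObject C] (A B : C) : HasSplitImage (0 : A ⟶ B) := by
  open ZeroObject in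
  exact ⟨0, 0, 0, ⟨⟨⟨0, by simp⟩⟩⟩, ⟨⟨⟨0, by simp⟩⟩⟩, zero_comp⟩

/-- One step of Gaussian elimination: `i ≫ f` is a pivot, and `f` is the direct sum of the pivot
and of the remaining morphism `f - f ≫ r ≫ i ≫ f`. -/
theorem HasSplitImage.of_pivot [HasBinaryBiproducts C] {A B S : C} {f : A ⟶ B} {i : S ⟶ A}
    {r : B ⟶ S} (hpivot : i ≫ f ≫ r = 𝟙 S) (h : HasSplitImage (f - f ≫ r ≫ i ≫ f)) :
    HasSplitImage f := by
  obtain ⟨Y, p, j, _, _, hpj⟩ := h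
  have hip : i ≫ p = 0 := by
    rw [← cancel_mono j, Category.assoc, hpj]
    simp [reassoc_of% hpivot]
  have hjr : j ≫ r = 0 := by
    rw [← cancel_epi p, ← Category.assoc, hpj]
    simp [hpivot]
  refine ⟨S ⊞ Y, biprod.lift (f ≫ r) p, biprod.desc (i ≫ f) j, ⟨⟨⟨?_, ?_⟩⟩⟩, ⟨⟨⟨?_, ?_⟩⟩⟩, ?_⟩
  · exact biprod.desc i (section_ p - section_ p ≫ f ≫ r ≫ i)
  · ext <;> simp [hpivot, hip]
  · exact biprod.lift r (retraction j - r ≫ i ≫ f ≫ retraction j)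
  · ext <;> simp [hpivot, hjr, reassoc_of% hpivot, reassoc_of% hjr]
  · simp [hpj]

end SplitImage

section Field

variable {k : Type w} [Field k] {C : Type u} [Category.{v} C] [Preadditive C] [Linear k C]

theorem isSplitSimple_of_forall_exists_eq_smul_id {X : C} (h0 : 𝟙 X ≠ 0)
    (h : ∀ f : X ⟶ X, ∃ c : k, f = c • 𝟙 X) : IsSplitSimple k X :=
  isSplitSimple_iff_bijective.2
    ⟨smul_left_injective k h0, fun f => (h f).imp fun _ hc => hc.symm⟩

namespace IsSplitSemisimple

theorem exists_retraction (hC : IsSplitSemisimple k C) {X Y : C} (hX : IsSplitSimple k X)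
    (hY : IsSplitSimple k Y) {f : X ⟶ Y} (hf : f ≠ 0) : ∃ g : Y ⟶ X, f ≫ g = 𝟙 X := by
  obtain ⟨e⟩ : Nonempty (X ≅ Y) := by
    by_contra h
    exact hf (hC.hom_eq_zero X Y hX hY (not_nonempty_iff.1 h) f)
  obtain ⟨c, hc⟩ := hX.exists_eq_smul_id (f ≫ e.inv)
  have hc0 : c ≠ 0 := by
    rintro rfl
    exact hf ((cancel_mono e.inv).1 (by rw [hc, zero_smul, zero_comp]))
  exact ⟨c⁻¹ • e.inv, by rw [Linear.comp_smul, hc, inv_smul_smul₀ hc0]⟩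

theorem exists_pivot (hC : IsSplitSemisimple k C) {A B : C} (d : SimpleDecomposition k A)
    {f : A ⟶ B} (hf : f ≠ 0) : ∃ (a : d.J) (r : B ⟶ d.S a), d.ι a ≫ f ≫ r = 𝟙 (d.S a) := by
  obtain ⟨d'⟩ := hC.nonempty_simpleDecomposition B
  obtain ⟨a, ha⟩ := d.exists_ι_comp_ne_zero hf
  obtain ⟨b, hb⟩ := d'.exists_comp_π_ne_zero ha
  obtain ⟨g, hg⟩ := hC.exists_retraction (d.simple a) (d'.simple b) hb
  exact ⟨a, d'.π b ≫ g, by simpa using hg⟩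

theorem hasSplitImage (hC : IsSplitSemisimple k C) {A B : C} (f : A ⟶ B) : HasSplitImage f := by
  classical
  have := hC.hasFiniteBiproducts
  have := hasBinaryBiproducts_of_finite_biproducts C
  obtain ⟨d⟩ := hC.nonempty_simpleDecomposition A
  induction hn : Finset.card {a | d.ι a ≫ f ≠ 0} using Nat.strong_induction_on generalizing f with
  | _ n ih =>
  by_cases hf : f = 0
  · exact hf ▸ hasSplitImage_zero A B
  obtain ⟨a, r, har⟩ := hC.exists_pivot d hf
  have ha : d.ι a ≫ f ≠ 0 := fun h =>
    (d.simple a).id_ne_zero (by rw [← har, reassoc_of% h, zero_comp])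
  refine .of_pivot har (ih _ ?_ _ rfl)
  refine hn ▸ Finset.card_lt_card ((Finset.ssubset_iff_of_subset fun b => ?_).2 ⟨a, ?_, ?_⟩)
  · simp only [Finset.mem_filter_univ]
    contrapose!
    intro hb
    simp [reassoc_of% hb, hb]
  · simpa using ha
  · simp [reassoc_of% har]

theorem isVonNeumannRegular (hC : IsSplitSemisimple k C) : IsVonNeumannRegular C :=
  isVonNeumannRegular_of_hasSplitImage fun _ _ => hC.hasSplitImage

theorem isIdempotentComplete (hC : IsSplitSemisimple k C) : IsIdempotentComplete C :=
  isIdempotentComplete_of_hasSplitImage fun _ _ => hC.hasSplitImage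

end IsSplitSemisimple

namespace IsVonNeumannRegular

theorem nonempty_iso (hC : IsVonNeumannRegular C) {X Y : C} (hX : IsSplitSimple k X)
    (hY : IsSplitSimple k Y) {f : X ⟶ Y} (hf : f ≠ 0) : Nonempty (X ≅ Y) := by
  obtain ⟨g, hg⟩ := hC f
  obtain ⟨c, hc⟩ := hX.exists_eq_smul_id (f ≫ g)
  obtain ⟨c', hc'⟩ := hY.exists_eq_smul_id (g ≫ f)
  have eq_one {a : k} (ha : a • f = f) : a = 1 :=
    smul_left_injective k hf (ha.trans (one_smul k f).symm)
  have hc1 : c = 1 :=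
    eq_one (by rw [← Category.id_comp f, ← Linear.smul_comp, ← hc]; simpa using hg)
  have hc1' : c' = 1 :=
    eq_one (by rw [← Category.comp_id f, ← Linear.comp_smul, ← hc']; simpa using hg)
  exact ⟨⟨f, g, by rw [hc, hc1, one_smul], by rw [hc', hc1', one_smul]⟩⟩

theorem exists_nontrivial_idempotent [IsAlgClosed k] (hC : IsVonNeumannRegular C) {A : C}
    [Module.Finite k (A ⟶ A)] (h0 : 𝟙 A ≠ 0) (hA : ¬ IsSplitSimple k A) :
    ∃ e : A ⟶ A, e ≫ e = e ∧ e ≠ 0 ∧ e ≠ 𝟙 A := by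
  obtain ⟨f, hf⟩ : ∃ f : A ⟶ A, ∀ c : k, f ≠ c • 𝟙 A := by
    by_contra! h
    exact hA (isSplitSimple_of_forall_exists_eq_smul_id h0 h)
  obtain ⟨g, hg0, hgu⟩ : ∃ g : A ⟶ A, g ≠ 0 ∧ ¬ IsIso g := by
    have : Module.Finite k (End A) := ‹Module.Finite k (A ⟶ A)›
    have : Nontrivial (End A) := ⟨⟨𝟙 A, 0, h0⟩⟩
    obtain ⟨c, hc⟩ := spectrum.nonempty_of_isAlgClosed_of_finiteDimensional k (A := End A) f
    refine ⟨c • 𝟙 A - f, fun h => hf c (sub_eq_zero.1 h).symm, ?_⟩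
    rwa [← isUnit_iff_isIso]
  obtain ⟨h, hh⟩ := hC g
  by_cases hgh : g ≫ h = 𝟙 A
  · refine ⟨h ≫ g, by simp [hh], fun hhg => hg0 ?_, fun hhg => hgu ⟨h, hgh, hhg⟩⟩
    rw [← hh, hhg, comp_zero]
  · refine ⟨g ≫ h, by simp [reassoc_of% hh], fun h' => hg0 ?_, hgh⟩
    rw [← hh, ← Category.assoc, h', zero_comp]

end IsVonNeumannRegular

theorem finrank_end_lt_of_retract {X Y : C} [Module.Finite k (X ⟶ X)] (s : Retract Y X)
    (hs : s.r ≫ s.i ≠ 𝟙 X) : Module.finrank k (Y ⟶ Y) < Module.finrank k (X ⟶ X) := by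
  let φ : (Y ⟶ Y) →ₗ[k] (X ⟶ X) := Linear.leftComp k X s.r ∘ₗ Linear.rightComp k Y s.i
  have hφ : Function.Injective φ := fun f g hfg => by
    simpa [φ] using s.i ≫= hfg =≫ s.r
  have hrange : LinearMap.range φ ≠ ⊤ := by
    intro h
    obtain ⟨f, hf⟩ : 𝟙 X ∈ LinearMap.range φ := h ▸ Submodule.mem_top
    have hf1 : f = 𝟙 Y := by simpa [φ] using s.i ≫= hf =≫ s.r
    exact hs (by simpa [φ, hf1] using hf)
  rw [← LinearMap.finrank_range_of_inj hφ]
  exact Submodule.finrank_lt hrange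

theorem nonempty_simpleDecomposition_of_isVonNeumannRegular [IsAlgClosed k]
    [IsIdempotentComplete C] (hC : IsVonNeumannRegular C)
    (hfin : ∀ A : C, Module.Finite k (A ⟶ A)) (A : C) : Nonempty (SimpleDecomposition k A) := by
  induction hn : Module.finrank k (A ⟶ A) using Nat.strong_induction_on generalizing A with
  | _ n ih =>
  by_cases h0 : 𝟙 A = 0
  · exact ⟨.ofIdEqZero h0⟩
  by_cases hA : IsSplitSimple k A
  · exact ⟨.ofIsSplitSimple hA⟩
  have split {e : A ⟶ A} (he : e ≫ e = e) (he1 : e ≠ 𝟙 A) :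
      ∃ (Y : C) (s : Retract Y A), s.r ≫ s.i = e ∧ Nonempty (SimpleDecomposition k Y) := by
    obtain ⟨Y, i, p, hip, rfl⟩ := IsIdempotentComplete.idempotents_split A e he
    have := finrank_end_lt_of_retract (k := k) ⟨i, p, hip⟩ he1
    exact ⟨Y, ⟨i, p, hip⟩, rfl, ih _ (hn ▸ this) Y rfl⟩
  have := hfin A
  obtain ⟨e, he, he0, he1⟩ := hC.exists_nontrivial_idempotent h0 hA
  obtain ⟨Y, s, hs, ⟨d⟩⟩ := split he he1
  obtain ⟨Z, t, ht, ⟨d'⟩⟩ := split (e := 𝟙 A - e) (by simp [he]) (by simpa using he0)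
  exact ⟨.ofRetracts s t (by simp [hs, ht]) d d'⟩

theorem isSplitSemisimple_of_isVonNeumannRegular [IsAlgClosed k] [HasFiniteBiproducts C]
    [IsIdempotentComplete C] (hC : IsVonNeumannRegular C)
    (hfin : ∀ A : C, Module.Finite k (A ⟶ A)) : IsSplitSemisimple k C where
  hasFiniteBiproducts := inferInstance
  exists_decomposition A :=
    (nonempty_simpleDecomposition_of_isVonNeumannRegular hC hfin A).some.exists_bicone
  hom_eq_zero X Y hX hY hXY f := by
    by_contra hf
    exact not_isEmpty_iff.2 (hC.nonempty_iso hX hY hf) hXY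

end Field

/-! ### Gluing half braidings -/

section WhiskerSum

variable {C : Type u} [Category.{v} C] [Preadditive C] [MonoidalCategory C] [MonoidalPreadditive C]
  {J : Type*} [Fintype J] {O : J → C} {P : C} {π : ∀ a, P ⟶ O a} {ι : ∀ a, O a ⟶ P}

theorem sum_whiskerLeft_comp_whiskerLeft (total : ∑ a, π a ≫ ι a = 𝟙 P) (X : C) :
    ∑ a, X ◁ π a ≫ X ◁ ι a = 𝟙 (X ⊗ P) := by
  simp_rw [← MonoidalCategory.whiskerLeft_comp]
  rw [← whiskerLeft_sum, total, whiskerLeft_id]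

theorem sum_whiskerRight_comp_whiskerRight (total : ∑ a, π a ≫ ι a = 𝟙 P) (X : C) :
    ∑ a, π a ▷ X ≫ ι a ▷ X = 𝟙 (P ⊗ X) := by
  simp_rw [← comp_whiskerRight]
  rw [← sum_whiskerRight, total, id_whiskerRight]

theorem hom_ext_of_comp_whiskerLeft (total : ∑ a, π a ≫ ι a = 𝟙 P) {X Y : C} {f g : Y ⟶ X ⊗ P}
    (h : ∀ a, f ≫ X ◁ π a = g ≫ X ◁ π a) : f = g := by
  rw [← Category.comp_id f, ← Category.comp_id g, ← sum_whiskerLeft_comp_whiskerLeft total X,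
    Preadditive.comp_sum, Preadditive.comp_sum]
  exact Finset.sum_congr rfl fun a _ => by rw [reassoc_of% h a]

end WhiskerSum

namespace RelativeCenter

variable {k : Type w} [CommRing k] {C : Type u} [Category.{v} C] [Preadditive C] [Linear k C]
  [MonoidalCategory C] [PivotalCategory C] {D : LinearPivotalSubcategory k C}

theorem hom_ext {A B : RelativeCenter D} {f g : A ⟶ B} (h : f.f = g.f) : f = g := Hom.ext h

section Glue

variable {J : Type*} [Fintype J] (A : J → RelativeCenter D) {P : C} (π : ∀ a, P ⟶ (A a).obj)
  (ι : ∀ a, (A a).obj ⟶ P)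

/-- The morphism `P ⊗ X ⟶ X ⊗ P` assembled from the half braidings `A a` along the morphisms `π a`
and `ι a`. -/
noncomputable def glueHom (X : D.Obj) : P ⊗ X.val ⟶ X.val ⊗ P :=
  ∑ a, π a ▷ X.val ≫ ((A a).σ X).hom ≫ X.val ◁ ι a

/-- The morphism `X ⊗ P ⟶ P ⊗ X` assembled from the inverses of the half braidings `A a`. -/
noncomputable def glueInv (X : D.Obj) : X.val ⊗ P ⟶ P ⊗ X.val :=
  ∑ a, X.val ◁ π a ≫ ((A a).σ X).inv ≫ ι a ▷ X.val

variable {A π ι}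

theorem glueHom_naturality {X Y : D.Obj} (f : X ⟶ Y) :
    P ◁ f.1 ≫ glueHom A π ι Y = glueHom A π ι X ≫ f.1 ▷ P := by
  rw [glueHom, glueHom, Preadditive.comp_sum, Preadditive.sum_comp]
  refine Finset.sum_congr rfl fun a _ => ?_
  rw [whisker_exchange_assoc, reassoc_of% ((A a).naturality f), Category.assoc, Category.assoc,
    whisker_exchange]

variable [MonoidalPreadditive C] [MonoidalLinear k C]
  (total : ∑ a, π a ≫ ι a = 𝟙 P) (hιπ : ∀ a b, ι a ≫ π b ∈ homSubmodule (A a) (A b))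

include total hιπ

theorem glueHom_comp_whiskerLeft (X : D.Obj) (b : J) :
    glueHom A π ι X ≫ X.val ◁ π b = π b ▷ X.val ≫ ((A b).σ X).hom := by
  calc glueHom A π ι X ≫ X.val ◁ π b
      = ∑ a, π a ▷ X.val ≫ ((A a).σ X).hom ≫ X.val ◁ (ι a ≫ π b) := by
        simp [glueHom, Preadditive.sum_comp]
    _ = (∑ a, π a ▷ X.val ≫ ι a ▷ X.val) ≫ π b ▷ X.val ≫ ((A b).σ X).hom := by
        simp only [hιπ _ b X, comp_whiskerRight, Preadditive.sum_comp, Category.assoc]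
    _ = π b ▷ X.val ≫ ((A b).σ X).hom := by
        rw [sum_whiskerRight_comp_whiskerRight total, Category.id_comp]

theorem whiskerRight_comp_glueHom (X : D.Obj) (b : J) :
    ι b ▷ X.val ≫ glueHom A π ι X = ((A b).σ X).hom ≫ X.val ◁ ι b := by
  calc ι b ▷ X.val ≫ glueHom A π ι X
      = ∑ a, ((ι b ≫ π a) ▷ X.val ≫ ((A a).σ X).hom) ≫ X.val ◁ ι a := by
        simp [glueHom, Preadditive.comp_sum]
    _ = (((A b).σ X).hom ≫ X.val ◁ ι b) ≫ ∑ a, X.val ◁ π a ≫ X.val ◁ ι a := by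
        simp only [← hιπ b _ X, MonoidalCategory.whiskerLeft_comp, Preadditive.comp_sum,
          Category.assoc]
    _ = ((A b).σ X).hom ≫ X.val ◁ ι b := by
        rw [sum_whiskerLeft_comp_whiskerLeft total, Category.comp_id]

theorem glueHom_comp_glueInv (X : D.Obj) : glueHom A π ι X ≫ glueInv A π ι X = 𝟙 _ := by
  rw [glueInv, Preadditive.comp_sum, ← sum_whiskerRight_comp_whiskerRight total]
  refine Finset.sum_congr rfl fun b _ => ?_
  rw [reassoc_of% glueHom_comp_whiskerLeft total hιπ X b, Iso.hom_inv_id_assoc]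

theorem glueInv_comp_glueHom (X : D.Obj) : glueInv A π ι X ≫ glueHom A π ι X = 𝟙 _ := by
  rw [glueInv, Preadditive.sum_comp, ← sum_whiskerLeft_comp_whiskerLeft total]
  refine Finset.sum_congr rfl fun b _ => ?_
  rw [Category.assoc, Category.assoc, whiskerRight_comp_glueHom total hιπ, Iso.inv_hom_id_assoc]

theorem glueHom_tensor (X Y : D.Obj) : glueHom A π ι (X ⊗ Y) =
    (α_ P X.val Y.val).inv ≫ glueHom A π ι X ▷ Y.val ≫ (α_ X.val P Y.val).hom ≫
      X.val ◁ glueHom A π ι Y ≫ (α_ X.val Y.val P).inv := by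
  refine hom_ext_of_comp_whiskerLeft total (X := X.val ⊗ Y.val) fun b => ?_
  refine (glueHom_comp_whiskerLeft total hιπ (X ⊗ Y) b).trans ?_
  rw [(A b).monoidal]
  change π b ▷ (X.val ⊗ Y.val) ≫ _ = _
  simp only [Category.assoc, MonoidalCategory.tensor_whiskerLeft, Iso.inv_hom_id_assoc]
  rw [← MonoidalCategory.whiskerLeft_comp_assoc, glueHom_comp_whiskerLeft total hιπ]
  simp only [MonoidalCategory.whiskerLeft_comp, Category.assoc]
  rw [← associator_naturality_middle_assoc, ← comp_whiskerRight_assoc,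
    glueHom_comp_whiskerLeft total hιπ, associator_inv_naturality_left_assoc]
  simp only [comp_whiskerRight, Category.assoc]

omit total hιπ

/-- The half braiding on an object `P` of `C` which is covered by half braidings `A a`, in such a
way that the transition morphisms `ι a ≫ π b` are morphisms of half braidings. -/
noncomputable def glue : RelativeCenter D where
  obj := P
  σ X := ⟨glueHom A π ι X, glueInv A π ι X, glueHom_comp_glueInv total hιπ X,
    glueInv_comp_glueHom total hιπ X⟩
  naturality := glueHom_naturality
  monoidal := glueHom_tensor total hιπ

/-- The projections of `glue`. -/
noncomputable def glueπ (a : J) : glue total hιπ ⟶ A a :=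
  ⟨π a, fun X => glueHom_comp_whiskerLeft total hιπ X a⟩

/-- The inclusions of `glue`. -/
noncomputable def glueι (a : J) : A a ⟶ glue total hιπ :=
  ⟨ι a, fun X => (whiskerRight_comp_glueHom total hιπ X a).symm⟩

end Glue

variable [MonoidalPreadditive C] [MonoidalLinear k C]

variable (k) in
/-- The inclusion of the morphisms of half braidings into the morphisms of `C`. -/
def forgetₗ (A B : RelativeCenter D) : (A ⟶ B) →ₗ[k] (A.obj ⟶ B.obj) where
  toFun f := f.f
  map_add' _ _ := rfl
  map_smul' _ _ := rfl

instance isIdempotentComplete [IsIdempotentComplete C] :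
    IsIdempotentComplete (RelativeCenter D) where
  idempotents_split A e he := by
    obtain ⟨Y, i, p, hip, hpi⟩ := IsIdempotentComplete.idempotents_split A.obj e.f
      (congrArg Hom.f he)
    have total : ∑ _ : Unit, i ≫ p = 𝟙 Y := by simp [hip]
    have hpi_mem : ∀ _ _ : Unit, p ≫ i ∈ homSubmodule A A := fun _ _ => hpi ▸ e.comm
    exact ⟨glue (A := fun _ => A) total hpi_mem, glueπ (A := fun _ => A) total hpi_mem (),
      glueι (A := fun _ => A) total hpi_mem (), hom_ext hip, hom_ext hpi⟩

instance hasFiniteBiproducts [HasFiniteBiproducts C] : HasFiniteBiproducts (RelativeCenter D) where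
  out n := ⟨fun F => by
    let b := biproduct.bicone fun a => (F a).obj
    have total : ∑ a, b.π a ≫ b.ι a = 𝟙 b.pt := biproduct.total
    have hιπ (a a') : b.ι a ≫ b.π a' ∈ homSubmodule (F a) (F a') := by
      by_cases h : a = a'
      · subst h
        rw [bicone_ι_π_self]
        exact Hom.comm (𝟙 (F a))
      · rw [bicone_ι_π_ne b h]
        exact zero_mem _
    let glued : Bicone F :=
      { pt := glue total hιπ
        π := glueπ total hιπ
        ι := glueι total hιπ
        ι_π a a' := by
          split_ifs with h
          · subst h
            exact hom_ext (bicone_ι_π_self b a)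
          · exact hom_ext (bicone_ι_π_ne b h) }
    exact hasBiproduct_of_total glued (hom_ext ((map_sum (forgetₗ k _ _) _ _).trans total))⟩

theorem finite_hom [IsNoetherianRing k] (A B : RelativeCenter D)
    [Module.Finite k (A.obj ⟶ B.obj)] : Module.Finite k (A ⟶ B) :=
  Module.Finite.of_injective (forgetₗ k A B) fun _ _ => hom_ext

end RelativeCenter

/-! ### Bending strands in pivotal categories -/

theorem smul_sum_eq_smul_sum_of_eq_sum_smul {R M₁ M₂ N K L : Type*} [CommSemiring R]
    [AddCommMonoid M₁] [AddCommMonoid M₂] [AddCommMonoid N] [Module R M₁] [Module R M₂]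
    [Module R N] [Fintype K] [Fintype L] (Ψ : M₁ →ₗ[R] M₂ →ₗ[R] N) {P : K → M₁} {Q : K → M₂}
    {U : L → M₁} {V : L → M₂} {c d : K → L → R} (hP : ∀ a, P a = ∑ b, c a b • U b)
    (hV : ∀ b, V b = ∑ a, d a b • Q a) {s t : R} (hcd : ∀ a b, s * c a b = t * d a b) :
    s • ∑ a, Ψ (P a) (Q a) = t • ∑ b, Ψ (U b) (V b) := by
  simp_rw [hP, hV, map_sum, map_smul, LinearMap.sum_apply, LinearMap.smul_apply, Finset.smul_sum,
    smul_smul, hcd]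
  exact Finset.sum_comm

namespace PivotalCategory

theorem nonempty_iso_dual {C : Type u} [Category.{v} C] [MonoidalCategory C] [PivotalCategory C]
    {X Y : C} (e : dual X ≅ Y) : Nonempty (X ≅ dual Y) :=
  letI := rightPairing X
  ⟨rightDualIso (exactPairingCongrLeft e.symm) (leftPairing Y)⟩

section Bend

variable (k : Type w) [CommRing k] {C : Type u} [Category.{v} C] [Preadditive C] [Linear k C]
  [MonoidalCategory C] [MonoidalPreadditive C] [MonoidalLinear k C] [PivotalCategory C]

/-- Bending the right input strand upwards. -/
def bendInRight (X i j : C) : (X ⊗ i ⟶ j) ≃ₗ[k] (X ⟶ j ⊗ dual i) where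
  __ := letI := leftPairing i; tensorRightHomEquiv X i (dual i) j
  map_add' f g := by simp [tensorRightHomEquiv]
  map_smul' c f := by simp [tensorRightHomEquiv]

/-- Bending the right output strand downwards. -/
def bendOutRight (X i j : C) : (j ⟶ X ⊗ i) ≃ₗ[k] (j ⊗ dual i ⟶ X) where
  __ := letI := rightPairing i; (tensorRightHomEquiv j (dual i) i X).symm
  map_add' f g := by simp [tensorRightHomEquiv]
  map_smul' c f := by simp [tensorRightHomEquiv]

/-- Bending the left input strand upwards. -/
def bendInLeft (X j Z : C) : (dual j ⊗ X ⟶ Z) ≃ₗ[k] (X ⟶ j ⊗ Z) where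
  __ := letI := leftPairing j; tensorLeftHomEquiv X j (dual j) Z
  map_add' f g := by simp [tensorLeftHomEquiv]
  map_smul' c f := by simp [tensorLeftHomEquiv]

/-- Bending the left output strand downwards. -/
def bendOutLeft (X j Z : C) : (Z ⟶ dual j ⊗ X) ≃ₗ[k] (j ⊗ Z ⟶ X) where
  __ := letI := rightPairing j; (tensorLeftHomEquiv Z (dual j) j X).symm
  map_add' f g := by simp [tensorLeftHomEquiv]
  map_smul' c f := by simp [tensorLeftHomEquiv]

/-- Duality as an isomorphism between modules of morphisms. -/
def dualHomEquiv (X Y : C) : (dual X ⟶ dual Y) ≃ₗ[k] (Y ⟶ X) :=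
  (Linear.homCongr k (λ_ (dual X)).symm (Iso.refl (dual Y))).trans <|
    (bendOutRight k (dual Y) X (𝟙_ C)).symm.trans <|
      (bendOutLeft k X Y (𝟙_ C)).trans <| Linear.homCongr k (ρ_ Y) (Iso.refl X)

variable {k}

theorem bendInRight_apply {X i j : C} (p : X ⊗ i ⟶ j) :
    bendInRight k X i j p = (ρ_ X).inv ≫ X ◁ coev i ≫ (α_ X i (dual i)).inv ≫ p ▷ dual i := rfl

theorem bendInRight_symm_apply {X i j : C} (x : X ⟶ j ⊗ dual i) :
    (bendInRight k X i j).symm x = x ▷ i ≫ (α_ j (dual i) i).hom ≫ j ◁ ev i ≫ (ρ_ j).hom := rfl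

theorem bendOutRight_apply {X i j : C} (q : j ⟶ X ⊗ i) :
    bendOutRight k X i j q =
      q ▷ dual i ≫ (α_ X i (dual i)).hom ≫ X ◁ evR i ≫ (ρ_ X).hom := rfl

theorem bendOutRight_symm_apply {X i j : C} (y : j ⊗ dual i ⟶ X) :
    (bendOutRight k X i j).symm y =
      (ρ_ j).inv ≫ j ◁ coevR i ≫ (α_ j (dual i) i).inv ≫ y ▷ i := rfl

theorem bendInLeft_apply {X j Z : C} (u : dual j ⊗ X ⟶ Z) :
    bendInLeft k X j Z u = (λ_ X).inv ≫ coev j ▷ X ≫ (α_ j (dual j) X).hom ≫ j ◁ u := rfl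

theorem bendInLeft_symm_apply {X j Z : C} (x : X ⟶ j ⊗ Z) :
    (bendInLeft k X j Z).symm x =
      dual j ◁ x ≫ (α_ (dual j) j Z).inv ≫ ev j ▷ Z ≫ (λ_ Z).hom := rfl

theorem bendOutLeft_apply {X j Z : C} (v : Z ⟶ dual j ⊗ X) :
    bendOutLeft k X j Z v = j ◁ v ≫ (α_ j (dual j) X).inv ≫ evR j ▷ X ≫ (λ_ X).hom := rfl

theorem bendOutLeft_symm_apply {X j Z : C} (y : j ⊗ Z ⟶ X) :
    (bendOutLeft k X j Z).symm y =
      (λ_ Z).inv ≫ coevR j ▷ Z ≫ (α_ (dual j) j Z).hom ≫ dual j ◁ y := rfl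

/-- Both sides are the closure of the endomorphism `y ≫ x` of `j ⊗ dual i`: on the left the strand
`i` is closed first, on the right the strand `j`. -/
theorem trL_bendRight_eq {X i j : C} (x : X ⟶ j ⊗ dual i) (y : j ⊗ dual i ⟶ X) :
    trL ((bendOutRight k X i j).symm y ≫ (bendInRight k X i j).symm x) =
      coevR i ≫ ((bendOutLeft k X j (dual i)).symm y ≫
        (bendInLeft k X j (dual i)).symm x) ▷ i ≫ ev i := by
  rw [trL, bendOutRight_symm_apply, bendInRight_symm_apply, bendOutLeft_symm_apply,
    bendInLeft_symm_apply]
  calc _ = 𝟙 _ ⊗≫ (coevR j ▷ 𝟙_ C ≫ (dual j ⊗ j) ◁ coevR i) ⊗≫ dual j ◁ y ▷ i ⊗≫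
          dual j ◁ x ▷ i ⊗≫ ((dual j ⊗ j) ◁ ev i ≫ ev j ▷ 𝟙_ C) ⊗≫ 𝟙 _ := by monoidal
    _ = 𝟙 _ ⊗≫ (𝟙_ C ◁ coevR i ≫ coevR j ▷ (dual i ⊗ i)) ⊗≫ dual j ◁ y ▷ i ⊗≫
          dual j ◁ x ▷ i ⊗≫ (ev j ▷ (dual i ⊗ i) ≫ 𝟙_ C ◁ ev i) ⊗≫ 𝟙 _ := by
        rw [whisker_exchange, whisker_exchange]
    _ = _ := by monoidal

theorem dimL_mul_eq_of_bend_eq_smul_id (hunit : IsSplitSimple k (𝟙_ C)) {X i j : C} {δi δj : k}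
    (hδi : dimL i = δi • 𝟙 (𝟙_ C)) (hδj : dimL j = δj • 𝟙 (𝟙_ C)) {x : X ⟶ j ⊗ dual i}
    {y : j ⊗ dual i ⟶ X} {c d : k}
    (hc : (bendOutLeft k X j (dual i)).symm y ≫ (bendInLeft k X j (dual i)).symm x = c • 𝟙 _)
    (hd : (bendOutRight k X i j).symm y ≫ (bendInRight k X i j).symm x = d • 𝟙 j) :
    δi * c = δj * d := by
  apply hunit.smul_id_injective
  calc (δi * c) • 𝟙 (𝟙_ C)
      = coevR i ≫ (c • 𝟙 (dual i)) ▷ i ≫ ev i := by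
        rw [mul_comm, mul_smul, ← hδi]
        simp [trL, dimL]
    _ = trL (d • 𝟙 j) := by rw [← hc, ← hd, trL_bendRight_eq]
    _ = (δj * d) • 𝟙 (𝟙_ C) := by
        rw [mul_comm, mul_smul, ← hδj]
        simp [trL, dimL]

/-- Up to left dimensions, the canonical tensors of the composition pairings on the right strand
and on the left strand agree. -/
theorem smul_sum_bend_eq {M : Type*} [AddCommGroup M] [Module k M] {X i j : C}
    (hunit : IsSplitSimple k (𝟙_ C)) (hi : IsSplitSimple k (dual i)) (hj : IsSplitSimple k j)
    {δi δj : k} (hδi : dimL i = δi • 𝟙 (𝟙_ C)) (hδj : dimL j = δj • 𝟙 (𝟙_ C))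
    {K L : Type*} [Fintype K] [Fintype L] {p : K → (X ⊗ i ⟶ j)} {q : K → (j ⟶ X ⊗ i)}
    (hpq : ∀ y : j ⟶ X ⊗ i, ∑ a, (y ≫ p a) ≫ q a = y)
    {u : L → (dual j ⊗ X ⟶ dual i)} {v : L → (dual i ⟶ dual j ⊗ X)}
    (huv : ∀ x : dual j ⊗ X ⟶ dual i, ∑ b, u b ≫ v b ≫ x = x)
    (Ψ : (X ⟶ j ⊗ dual i) →ₗ[k] (j ⊗ dual i ⟶ X) →ₗ[k] M) :
    δi • ∑ a, Ψ (bendInRight k X i j (p a)) (bendOutRight k X i j (q a)) =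
      δj • ∑ b, Ψ (bendInLeft k X j (dual i) (u b)) (bendOutLeft k X j (dual i) (v b)) := by
  let x a := (bendInLeft k X j (dual i)).symm (bendInRight k X i j (p a))
  let y b := (bendOutRight k X i j).symm (bendOutLeft k X j (dual i) (v b))
  choose c hc using fun a b => hi.exists_eq_smul_id (v b ≫ x a)
  choose d hd using fun a b => hj.exists_eq_smul_id (y b ≫ p a)
  refine smul_sum_eq_smul_sum_of_eq_sum_smul Ψ (c := c) (d := d) (fun a => ?_) (fun b => ?_)
    fun a b => dimL_mul_eq_of_bend_eq_smul_id hunit hδi hδj (x := bendInRight k X i j (p a))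
      (y := bendOutLeft k X j (dual i) (v b)) (by simpa using hc a b) (by simpa using hd a b)
  · apply (bendInLeft k X j (dual i)).symm.injective
    rw [map_sum]
    simpa [hc] using (huv (x a)).symm
  · apply (bendOutRight k X i j).symm.injective
    rw [map_sum]
    simpa [hd] using (hpq (y b)).symm

end Bend

end PivotalCategory

section CompleteFamily

variable {k : Type w} [CommRing k] {C : Type u} [Category.{v} C] [Preadditive C] [Linear k C]
  {I : Type*} {T : I → C}

variable (k) in
/-- A family of simple objects that represents every isomorphism class of simple objects exactly
once; distinct members are required to have no nonzero morphisms between them. -/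
structure IsCompleteSimpleFamily (T : I → C) : Prop where
  simple : ∀ i, IsSplitSimple k (T i)
  hom_eq_zero : ∀ i j, i ≠ j → ∀ f : T i ⟶ T j, f = 0
  exists_iso : ∀ S : C, IsSplitSimple k S → ∃ i, Nonempty (S ≅ T i)

theorem isCompleteSimpleFamily_out (hC : IsSplitSemisimple k C) :
    IsCompleteSimpleFamily k fun c : SimpleClasses k C => c.1.out where
  simple c := c.2
  hom_eq_zero c c' h := by
    refine hC.hom_eq_zero _ _ c.2 c'.2 ⟨fun e => h (Subtype.ext ?_)⟩
    rw [← c.1.out_eq, ← c'.1.out_eq]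
    exact Quotient.sound ⟨e⟩
  exists_iso S hS := by
    obtain ⟨e⟩ : Nonempty ((Quotient.mk (isIsomorphicSetoid C) S).out ≅ S) :=
      Quotient.mk_out (s := isIsomorphicSetoid C) S
    exact ⟨⟨Quotient.mk _ S, hS.of_iso e.symm⟩, ⟨e.symm⟩⟩

section Dual

open PivotalCategory

variable [MonoidalCategory C] [MonoidalPreadditive C] [MonoidalLinear k C] [PivotalCategory C]

theorem IsSplitSimple.dual {S : C} (hS : IsSplitSimple k S) :
    IsSplitSimple k (PivotalCategory.dual S) := by
  let φ := dualHomEquiv k S S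
  have := hS.1
  exact ⟨Module.Free.of_equiv φ.symm, φ.rank_eq.trans hS.2⟩

theorem IsCompleteSimpleFamily.dual (hT : IsCompleteSimpleFamily k T) :
    IsCompleteSimpleFamily k fun i => PivotalCategory.dual (T i) where
  simple i := (hT.simple i).dual
  hom_eq_zero i j h _ := (dualHomEquiv k _ _).map_eq_zero_iff.1 (hT.hom_eq_zero j i h.symm _)
  exists_iso _ hS :=
    let ⟨i, ⟨e⟩⟩ := hT.exists_iso _ hS.dual
    ⟨i, nonempty_iso_dual e⟩

end Dual

/-- A resolution of the identity of `Y` by morphisms through the objects of the family `T`, where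
`T i` is used once for each index in `K i`. -/
structure FamilyResolution [Fintype I] (T : I → C) (Y : C) where
  K : I → Type
  [fintype : ∀ i, Fintype (K i)]
  p : ∀ i, K i → (Y ⟶ T i)
  q : ∀ i, K i → (T i ⟶ Y)
  total : ∑ i, ∑ a, p i a ≫ q i a = 𝟙 Y

attribute [instance] FamilyResolution.fintype

namespace IsCompleteSimpleFamily

variable [Fintype I] {Y : C}

theorem nonempty_resolution (hC : IsSplitSemisimple k C) (hT : IsCompleteSimpleFamily k T)
    (Y : C) : Nonempty (FamilyResolution T Y) := by
  classical
  obtain ⟨d⟩ := hC.nonempty_simpleDecomposition Y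
  choose cls e using fun a => hT.exists_iso (d.S a) (d.simple a)
  have iso : ∀ i, ∀ a : {a // cls a = i}, Nonempty (d.S a ≅ T i) := by
    rintro _ ⟨a, rfl⟩
    exact e a
  refine ⟨⟨fun i => {a // cls a = i}, fun i a => d.π a ≫ (iso i a).some.hom,
    fun i a => (iso i a).some.inv ≫ d.ι a, ?_⟩⟩
  simp only [Category.assoc, Iso.hom_inv_id_assoc]
  exact (Fintype.sum_fiberwise cls fun a => d.π a ≫ d.ι a).trans d.total

theorem sum_comp_resolution (hT : IsCompleteSimpleFamily k T) (r : FamilyResolution T Y) {i : I}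
    (y : T i ⟶ Y) : ∑ a, (y ≫ r.p i a) ≫ r.q i a = y := by
  calc ∑ a, (y ≫ r.p i a) ≫ r.q i a = ∑ j, ∑ a, (y ≫ r.p j a) ≫ r.q j a := by
        symm
        refine Fintype.sum_eq_single i fun j hj => Finset.sum_eq_zero fun a _ => ?_
        rw [hT.hom_eq_zero i j hj.symm (y ≫ _), zero_comp]
    _ = y ≫ ∑ j, ∑ a, r.p j a ≫ r.q j a := by simp only [Preadditive.comp_sum, Category.assoc]
    _ = y := by rw [r.total, Category.comp_id]

theorem sum_resolution_comp (hT : IsCompleteSimpleFamily k T) (r : FamilyResolution T Y) {i : I}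
    (x : Y ⟶ T i) : ∑ a, r.p i a ≫ r.q i a ≫ x = x := by
  calc ∑ a, r.p i a ≫ r.q i a ≫ x = ∑ j, ∑ a, r.p j a ≫ r.q j a ≫ x := by
        symm
        refine Fintype.sum_eq_single i fun j hj => Finset.sum_eq_zero fun a _ => ?_
        rw [hT.hom_eq_zero j i hj (_ ≫ x), comp_zero]
    _ = (∑ j, ∑ a, r.p j a ≫ r.q j a) ≫ x := by simp only [Preadditive.sum_comp, Category.assoc]
    _ = x := by rw [r.total, Category.id_comp]

end IsCompleteSimpleFamily

end CompleteFamily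

open PivotalCategory in
theorem pivotalDim_eq_smul_id {k : Type w} [CommRing k] {C : Type u} [Category.{v} C]
    [Preadditive C] [Linear k C] [MonoidalCategory C] [PivotalCategory C]
    [Fintype (SimpleClasses k C)] {δ ε : SimpleClasses k C → k}
    (hδ : ∀ c, dimL c.1.out = δ c • 𝟙 (𝟙_ C)) (hε : ∀ c, dimR c.1.out = ε c • 𝟙 (𝟙_ C)) :
    pivotalDim k C = (∑ c, δ c * ε c) • 𝟙 (𝟙_ C) := by
  rw [pivotalDim, finsum_eq_sum_of_fintype, Finset.sum_smul]
  refine Finset.sum_congr rfl fun c _ => ?_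
  rw [hδ, hε, End.mul_def, Linear.smul_comp, Linear.comp_smul, Category.id_comp, smul_smul,
    mul_comm]

/-! ### Partial traces -/

section Sandwich

variable {C : Type u} [Category.{v} C] [MonoidalCategory C]

/-- A morphism `A ⊗ j ⟶ B ⊗ j` sandwiched between morphisms `X ⟶ j ⊗ Z` and `j ⊗ Z ⟶ X`. -/
def sandwich {A B j X Z : C} (g : A ⊗ j ⟶ B ⊗ j) (x : X ⟶ j ⊗ Z) (y : j ⊗ Z ⟶ X) :
    A ⊗ X ⟶ B ⊗ X :=
  A ◁ x ≫ (α_ A j Z).inv ≫ g ▷ Z ≫ (α_ B j Z).hom ≫ B ◁ y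

theorem sandwich_slide {A B j X Z Z' : C} (g : A ⊗ j ⟶ B ⊗ j) (x : X ⟶ j ⊗ Z) (u : Z ⟶ Z')
    (y : j ⊗ Z' ⟶ X) : sandwich g (x ≫ j ◁ u) y = sandwich g x (j ◁ u ≫ y) := by
  simp only [sandwich, MonoidalCategory.whiskerLeft_comp, Category.assoc]
  rw [associator_inv_naturality_right_assoc, whisker_exchange_assoc,
    associator_naturality_right_assoc]

end Sandwich

namespace PivotalCategory

section PartialTrace

variable {k : Type w} [CommRing k] {C : Type u} [Category.{v} C] [MonoidalCategory C]
  [PivotalCategory C]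

/-- The right partial trace over `Y`. -/
def ptrR {A B : C} (Y : C) (g : A ⊗ Y ⟶ B ⊗ Y) : A ⟶ B :=
  (ρ_ A).inv ≫ A ◁ coev Y ≫ (α_ A Y (dual Y)).inv ≫ g ▷ dual Y ≫ (α_ B Y (dual Y)).hom ≫
    B ◁ evR Y ≫ (ρ_ B).hom

/-- The right partial trace over the second factor of `X ⊗ Y`. -/
def ptrRTensor {A B : C} (X Y : C) (g : A ⊗ X ⊗ Y ⟶ B ⊗ X ⊗ Y) : A ⊗ X ⟶ B ⊗ X :=
  ptrR Y ((α_ A X Y).hom ≫ g ≫ (α_ B X Y).inv)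

theorem ptrR_whiskerRight_comp {A A' B Y : C} (f : A' ⟶ A) (g : A ⊗ Y ⟶ B ⊗ Y) :
    ptrR Y (f ▷ Y ≫ g) = f ≫ ptrR Y g := by
  simp only [ptrR, comp_whiskerRight, Category.assoc]
  rw [← associator_inv_naturality_left_assoc, whisker_exchange_assoc,
    ← rightUnitor_inv_naturality_assoc]

theorem ptrR_comp_whiskerRight {A B B' Y : C} (g : A ⊗ Y ⟶ B ⊗ Y) (f : B ⟶ B') :
    ptrR Y (g ≫ f ▷ Y) = ptrR Y g ≫ f := by
  simp only [ptrR, comp_whiskerRight, Category.assoc]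
  rw [associator_naturality_left_assoc, ← whisker_exchange_assoc, rightUnitor_naturality]

theorem comp_whiskerLeft_ptrR_comp {A B X Y : C} (s : A ⊗ X ⟶ X ⊗ A) (g : A ⊗ Y ⟶ B ⊗ Y)
    (t : X ⊗ B ⟶ B ⊗ X) :
    s ≫ X ◁ ptrR Y g ≫ t =
      ptrRTensor X Y ((α_ A X Y).inv ≫ s ▷ Y ≫ (α_ X A Y).hom ≫ X ◁ g ≫ (α_ X B Y).inv ≫
        t ▷ Y ≫ (α_ B X Y).hom) := by
  calc s ≫ X ◁ ptrR Y g ≫ t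
      = s ≫ ptrR Y ((α_ X A Y).hom ≫ X ◁ g ≫ (α_ X B Y).inv) ≫ t := by
        simp only [ptrR]
        monoidal
    _ = ptrR Y (s ▷ Y ≫ ((α_ X A Y).hom ≫ X ◁ g ≫ (α_ X B Y).inv) ≫ t ▷ Y) := by
        rw [ptrR_whiskerRight_comp, ptrR_comp_whiskerRight]
    _ = _ := by simp [ptrRTensor]

variable [Preadditive C] [Linear k C] [MonoidalPreadditive C] [MonoidalLinear k C]

theorem ptrRTensor_conj {A B X i j : C} (p : X ⊗ i ⟶ j) (g : A ⊗ j ⟶ B ⊗ j) (q : j ⟶ X ⊗ i) :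
    ptrRTensor X i (A ◁ p ≫ g ≫ B ◁ q) =
      sandwich g (bendInRight k X i j p) (bendOutRight k X i j q) := by
  rw [bendInRight_apply, bendOutRight_apply]
  simp only [ptrRTensor, ptrR, sandwich]
  monoidal

theorem ptrR_whiskerRight {A B X j : C} (g : A ⊗ j ⟶ B ⊗ j) :
    ptrR j g ▷ X = sandwich g (bendInLeft k X j _ (𝟙 _)) (bendOutLeft k X j _ (𝟙 _)) := by
  rw [bendInLeft_apply, bendOutLeft_apply]
  simp only [ptrR, sandwich]
  monoidal

theorem sandwich_bendLeft {A B X Z j : C} (g : A ⊗ j ⟶ B ⊗ j) (u : dual j ⊗ X ⟶ Z)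
    (v : Z ⟶ dual j ⊗ X) : sandwich g (bendInLeft k X j Z u) (bendOutLeft k X j Z v) =
      sandwich g (bendInLeft k X j _ (𝟙 _)) (bendOutLeft k X j _ (u ≫ v)) := by
  have hu : bendInLeft k X j Z u = bendInLeft k X j _ (𝟙 _) ≫ j ◁ u := by
    simp [bendInLeft_apply]
  have hv : bendOutLeft k X j _ (u ≫ v) = j ◁ u ≫ bendOutLeft k X j Z v := by
    simp [bendOutLeft_apply]
  rw [hu, hv, sandwich_slide]

variable (k) in
/-- `ptrRTensor` as a linear map. -/
def ptrRTensorₗ (A B X Y : C) : (A ⊗ X ⊗ Y ⟶ B ⊗ X ⊗ Y) →ₗ[k] (A ⊗ X ⟶ B ⊗ X) where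
  toFun := ptrRTensor X Y
  map_add' f g := by simp [ptrRTensor, ptrR]
  map_smul' c f := by simp [ptrRTensor, ptrR]

variable (k) in
/-- `sandwich` as a bilinear map. -/
def sandwichₗ {A B j : C} (X Z : C) (g : A ⊗ j ⟶ B ⊗ j) :
    (X ⟶ j ⊗ Z) →ₗ[k] (j ⊗ Z ⟶ X) →ₗ[k] (A ⊗ X ⟶ B ⊗ X) :=
  LinearMap.mk₂ k (sandwich g) (by simp [sandwich]) (by simp [sandwich]) (by simp [sandwich])
    (by simp [sandwich])

theorem ptrR_whiskerRight_eq_smul {A B Y : C} (f : A ⟶ B) {c : k}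
    (hc : dimR Y = c • 𝟙 (𝟙_ C)) : ptrR Y (f ▷ Y) = c • f := by
  have hloop : coev Y ≫ evR Y = c • 𝟙 (𝟙_ C) := by
    rw [← hc]
    simp [dimR, trR]
  have hid : ptrR Y (𝟙 (A ⊗ Y)) = c • 𝟙 A := by
    simp [ptrR, ← MonoidalCategory.whiskerLeft_comp_assoc, hloop]
  calc ptrR Y (f ▷ Y) = ptrR Y (𝟙 (A ⊗ Y) ≫ f ▷ Y) := by rw [Category.id_comp]
    _ = c • f := by rw [ptrR_comp_whiskerRight, hid, Linear.smul_comp, Category.id_comp]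

end PartialTrace

end PivotalCategory

namespace LinearPivotalSubcategory

variable {k : Type w} [CommRing k] {C : Type u} [Category.{v} C] [Preadditive C] [Linear k C]
  [MonoidalCategory C] [PivotalCategory C] (D : LinearPivotalSubcategory k C)

instance [MonoidalPreadditive C] : MonoidalPreadditive D.Obj where
  whiskerLeft_zero := Subtype.ext MonoidalPreadditive.whiskerLeft_zero
  zero_whiskerRight := Subtype.ext MonoidalPreadditive.zero_whiskerRight
  whiskerLeft_add f g := Subtype.ext (MonoidalPreadditive.whiskerLeft_add f.1 g.1)
  add_whiskerRight f g := Subtype.ext (MonoidalPreadditive.add_whiskerRight f.1 g.1)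

instance [MonoidalPreadditive C] [MonoidalLinear k C] : MonoidalLinear k D.Obj where
  whiskerLeft_smul X _ _ r f := Subtype.ext (MonoidalLinear.whiskerLeft_smul X.val r f.1)
  smul_whiskerRight r _ _ f X := Subtype.ext (MonoidalLinear.smul_whiskerRight r f.1 X.val)

/-- The inclusion of the morphisms of `D` into those of `C`. -/
def inclₗ (X Y : D.Obj) : (X ⟶ Y) →ₗ[k] (X.val ⟶ Y.val) := (D.hom X.val Y.val).subtype

variable {D}

theorem sum_resolution_val {I : Type*} [Fintype I] {T : I → D.Obj} {Y : D.Obj}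
    (r : FamilyResolution T Y) : ∑ i, ∑ a, (r.p i a).1 ≫ (r.q i a).1 = 𝟙 Y.val := by
  have h := congrArg (D.inclₗ Y Y) r.total
  simp only [map_sum] at h
  exact h

theorem isSplitSimple_of_val {X : D.Obj} (hX : IsSplitSimple k X.val) : IsSplitSimple k X :=
  isSplitSimple_iff_bijective.2
    ⟨fun _ _ h => hX.smul_id_injective (congrArg Subtype.val h), fun f =>
      (hX.exists_eq_smul_id f.1).imp fun _ h => Subtype.ext h.symm⟩

end LinearPivotalSubcategory

/-! ### Averaging over the simple objects of the subcategory -/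

namespace RelativeCenter

open PivotalCategory LinearPivotalSubcategory

variable {k : Type w} [CommRing k] {C : Type u} [Category.{v} C] [Preadditive C] [Linear k C]
  [MonoidalCategory C] [PivotalCategory C] {D : LinearPivotalSubcategory k C}
  {A A' B B' : RelativeCenter D}

/-- The conjugate of a morphism of `C` by half braidings. -/
def twist (f : A.obj ⟶ B.obj) (X : D.Obj) : A.obj ⊗ X.val ⟶ B.obj ⊗ X.val :=
  (A.σ X).hom ≫ X.val ◁ f ≫ (B.σ X).inv

theorem twist_naturality (f : A.obj ⟶ B.obj) {X Y : D.Obj} (g : X ⟶ Y) :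
    A.obj ◁ g.1 ≫ twist f Y = twist f X ≫ B.obj ◁ g.1 := by
  have hB : g.1 ▷ B.obj ≫ (B.σ Y).inv = (B.σ X).inv ≫ B.obj ◁ g.1 := by
    rw [Iso.comp_inv_eq, Category.assoc, B.naturality g, Iso.inv_hom_id_assoc]
  rw [twist, twist, reassoc_of% (A.naturality g), ← whisker_exchange_assoc, hB, Category.assoc,
    Category.assoc]

theorem σ_tensor_inv (B : RelativeCenter D) (X Y : D.Obj) : (B.σ (X ⊗ Y)).inv =
    (α_ X.val Y.val B.obj).hom ≫ X.val ◁ (B.σ Y).inv ≫ (α_ X.val B.obj Y.val).inv ≫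
      (B.σ X).inv ▷ Y.val ≫ (α_ B.obj X.val Y.val).hom := by
  rw [← cancel_epi (B.σ (X ⊗ Y)).hom, Iso.hom_inv_id, B.monoidal]
  change 𝟙 (B.obj ⊗ X.val ⊗ Y.val) = _
  simp only [Category.assoc, Iso.inv_hom_id_assoc, Iso.hom_inv_id_assoc,
    ← MonoidalCategory.whiskerLeft_comp_assoc, ← comp_whiskerRight_assoc, Iso.hom_inv_id,
    Iso.inv_hom_id, whiskerLeft_id, id_whiskerRight, Category.id_comp]
  rfl

theorem twist_tensor (f : A.obj ⟶ B.obj) (X Y : D.Obj) :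
    twist f (X ⊗ Y) = (α_ A.obj X.val Y.val).inv ≫ (A.σ X).hom ▷ Y.val ≫
      (α_ X.val A.obj Y.val).hom ≫ X.val ◁ twist f Y ≫ (α_ X.val B.obj Y.val).inv ≫
        (B.σ X).inv ▷ Y.val ≫ (α_ B.obj X.val Y.val).hom := by
  rw [twist, A.monoidal, σ_tensor_inv]
  change _ ≫ (X.val ⊗ Y.val) ◁ f ≫ _ = _
  simp only [twist]
  monoidal

theorem twist_comp_left (g : A' ⟶ A) (f : A.obj ⟶ B.obj) (X : D.Obj) :
    twist (g.f ≫ f) X = g.f ▷ X.val ≫ twist f X := by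
  simp only [twist, MonoidalCategory.whiskerLeft_comp, Category.assoc]
  rw [reassoc_of% (g.comm X)]

theorem twist_comp_right (f : A.obj ⟶ B.obj) (g : B ⟶ B') (X : D.Obj) :
    twist (f ≫ g.f) X = twist f X ≫ g.f ▷ X.val := by
  have hg : X.val ◁ g.f ≫ (B'.σ X).inv = (B.σ X).inv ≫ g.f ▷ X.val := by
    rw [Iso.comp_inv_eq, Category.assoc, ← g.comm X, Iso.inv_hom_id_assoc]
  simp only [twist, MonoidalCategory.whiskerLeft_comp, Category.assoc, hg]

theorem twist_hom (f : A ⟶ B) (X : D.Obj) : twist f.f X = f.f ▷ X.val := by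
  rw [twist, reassoc_of% (f.comm X), Iso.hom_inv_id, Category.comp_id]

section Average

variable {I : Type*} [Fintype I] (T : I → D.Obj) (δ : I → k)

/-- The average of a morphism of `C` with respect to a finite family of objects of `D` with
weights `δ`. -/
noncomputable def average (f : A.obj ⟶ B.obj) : A.obj ⟶ B.obj :=
  ∑ i, δ i • ptrR (T i).val (twist f (T i))

theorem average_comp_left (g : A' ⟶ A) (f : A.obj ⟶ B.obj) :
    average T δ (g.f ≫ f) = g.f ≫ average T δ f := by
  simp only [average, Preadditive.comp_sum, twist_comp_left, ptrR_whiskerRight_comp,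
    Linear.comp_smul]

theorem average_comp_right (f : A.obj ⟶ B.obj) (g : B ⟶ B') :
    average T δ (f ≫ g.f) = average T δ f ≫ g.f := by
  simp only [average, Preadditive.sum_comp, twist_comp_right, ptrR_comp_whiskerRight,
    Linear.smul_comp]

variable {T δ} [MonoidalPreadditive C]

theorem twist_eq_sum_resolution (f : A.obj ⟶ B.obj) {Y : D.Obj} (r : FamilyResolution T Y) :
    twist f Y = ∑ j, ∑ a, A.obj ◁ (r.p j a).1 ≫ twist f (T j) ≫ B.obj ◁ (r.q j a).1 := by
  rw [← Category.comp_id (twist f Y), ← whiskerLeft_id, ← sum_resolution_val r]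
  simp only [whiskerLeft_sum, Preadditive.comp_sum, MonoidalCategory.whiskerLeft_comp,
    reassoc_of% twist_naturality f]

variable [MonoidalLinear k C]

theorem average_hom (f : A ⟶ B) {ε : I → k} (hε : ∀ i, dimR (T i) = ε i • 𝟙 (𝟙_ D.Obj)) :
    average T δ f.f = (∑ i, δ i * ε i) • f.f := by
  rw [average, Finset.sum_smul]
  refine Finset.sum_congr rfl fun i _ => ?_
  have h : dimR (T i).val = ε i • 𝟙 (𝟙_ C) := congrArg Subtype.val (hε i)
  rw [twist_hom, ptrR_whiskerRight_eq_smul f.f h, mul_smul]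

/-- The sandwiches of the morphism `twist f j` by morphisms of `D`, as a bilinear map. -/
noncomputable def sandwichTwist (f : A.obj ⟶ B.obj) (X j Z : D.Obj) :
    (X ⟶ j ⊗ Z) →ₗ[k] (j ⊗ Z ⟶ X) →ₗ[k] (A.obj ⊗ X.val ⟶ B.obj ⊗ X.val) :=
  (sandwichₗ k X.val Z.val (twist f j)).compl₁₂ (D.inclₗ X (j ⊗ Z)) (D.inclₗ (j ⊗ Z) X)

theorem ptrRTensor_twist (f : A.obj ⟶ B.obj) (X i : D.Obj) (r : FamilyResolution T (X ⊗ i)) :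
    ptrRTensor X.val i.val (twist f (X ⊗ i)) = ∑ j, ∑ a, sandwichTwist f X (T j) (dual i)
      (bendInRight k X i (T j) (r.p j a)) (bendOutRight k X i (T j) (r.q j a)) := by
  rw [twist_eq_sum_resolution f r]
  change ptrRTensorₗ k A.obj B.obj X.val i.val _ = _
  simp only [map_sum]
  exact Finset.sum_congr rfl fun j _ => Finset.sum_congr rfl fun a _ =>
    ptrRTensor_conj (k := k) _ _ _

theorem ptrR_twist_whiskerRight (f : A.obj ⟶ B.obj) (X j : D.Obj)
    (r : FamilyResolution (fun i => dual (T i)) (dual j ⊗ X)) :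
    ptrR j.val (twist f j) ▷ X.val = ∑ i, ∑ b, sandwichTwist f X j (dual (T i))
      (bendInLeft k X j (dual (T i)) (r.p i b)) (bendOutLeft k X j (dual (T i)) (r.q i b)) := by
  have hid : 𝟙 (dual j.val ⊗ X.val) = ∑ i, ∑ b, (r.p i b).1 ≫ (r.q i b).1 :=
    (sum_resolution_val r).symm
  rw [ptrR_whiskerRight (k := k)]
  conv_lhs => enter [3]; rw [hid]
  change sandwichₗ k X.val (dual j.val ⊗ X.val) (twist f j) _ _ = _
  simp only [map_sum]
  exact Finset.sum_congr rfl fun i _ => Finset.sum_congr rfl fun b _ =>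
    (sandwich_bendLeft (k := k) (twist f j) (r.p i b).1 (r.q i b).1).symm

/-- The left dimensions are the weights that make the average natural: they compensate for the
factors by which the bent dual bases differ. -/
theorem average_mem (hunit : IsSplitSimple k (𝟙_ D.Obj)) (hD : IsSplitSemisimple k D.Obj)
    (hT : IsCompleteSimpleFamily k T) (hδ : ∀ i, dimL (T i) = δ i • 𝟙 (𝟙_ D.Obj))
    (f : A.obj ⟶ B.obj) : average T δ f ∈ homSubmodule A B := by
  intro X
  have r i := (hT.nonempty_resolution hD (X ⊗ T i)).some
  have r' j := (hT.dual.nonempty_resolution hD (dual (T j) ⊗ X)).some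
  rw [← Iso.comp_inv_eq, Category.assoc]
  calc (A.σ X).hom ≫ X.val ◁ average T δ f ≫ (B.σ X).inv
      = ∑ i, δ i • ptrRTensor X.val (T i).val (twist f (X ⊗ T i)) := by
        simp [average, whiskerLeft_sum, Preadditive.sum_comp, Preadditive.comp_sum,
          comp_whiskerLeft_ptrR_comp, twist_tensor]
    _ = ∑ i, ∑ j, δ i • ∑ a, sandwichTwist f X (T j) (dual (T i))
          (bendInRight k X (T i) (T j) ((r i).p j a))
          (bendOutRight k X (T i) (T j) ((r i).q j a)) := by
        simp only [fun i => ptrRTensor_twist f X (T i) (r i), Finset.smul_sum]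
    _ = ∑ i, ∑ j, δ j • ∑ b, sandwichTwist f X (T j) (dual (T i))
          (bendInLeft k X (T j) (dual (T i)) ((r' j).p i b))
          (bendOutLeft k X (T j) (dual (T i)) ((r' j).q i b)) :=
        Finset.sum_congr rfl fun i _ => Finset.sum_congr rfl fun j _ =>
          smul_sum_bend_eq hunit (hT.dual.simple i) (hT.simple j) (hδ i) (hδ j)
            (hT.sum_comp_resolution (r i)) (hT.dual.sum_resolution_comp (r' j)) _
    _ = ∑ j, δ j • ptrR (T j).val (twist f (T j)) ▷ X.val := by
        rw [Finset.sum_comm]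
        simp only [fun j => ptrR_twist_whiskerRight f X (T j) (r' j), Finset.smul_sum]
    _ = average T δ f ▷ X.val := by simp [average, sum_whiskerRight]

end Average

theorem isVonNeumannRegular {k : Type w} [Field k] {C : Type u} [Category.{v} C] [Preadditive C]
    [Linear k C] [MonoidalCategory C] [MonoidalPreadditive C] [MonoidalLinear k C]
    [PivotalCategory C] (hC : IsVonNeumannRegular C) {D : LinearPivotalSubcategory k C}
    (hunit : IsSplitSimple k (𝟙_ D.Obj)) (hD : IsSplitSemisimple k D.Obj)
    (hfin : Finite (SimpleClasses k D.Obj)) (hdim : pivotalDim k D.Obj ≠ 0) :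
    IsVonNeumannRegular (RelativeCenter D) := by
  intro A B f
  have := Fintype.ofFinite (SimpleClasses k D.Obj)
  let T : SimpleClasses k D.Obj → D.Obj := fun c => c.1.out
  choose δ hδ using fun c => hunit.exists_eq_smul_id (dimL (T c))
  choose ε hε using fun c => hunit.exists_eq_smul_id (dimR (T c))
  have hs : ∑ c, δ c * ε c ≠ 0 := fun h =>
    hdim (by rw [pivotalDim_eq_smul_id hδ hε, h, zero_smul])
  obtain ⟨g, hg⟩ := hC f.f
  let g' : B ⟶ A := ⟨average T δ g, average_mem hunit hD (isCompleteSimpleFamily_out hD) hδ g⟩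
  have hg' : f ≫ g' ≫ f = (∑ c, δ c * ε c) • f := hom_ext <| by
    calc f.f ≫ average T δ g ≫ f.f = average T δ f.f := by
          rw [← average_comp_right, ← average_comp_left, hg]
      _ = (∑ c, δ c * ε c) • f.f := average_hom f hε
  exact ⟨(∑ c, δ c * ε c)⁻¹ • g', by simp [hg', smul_smul, hs]⟩

end RelativeCenter

theorem lemma4p5_general {k : Type w} [Field k] [IsAlgClosed k] {C : Type u} [Category.{v} C]
    [Preadditive C] [Linear k C] [MonoidalCategory C] [MonoidalPreadditive C]
    [MonoidalLinear k C] [PivotalCategory C] (hC : IsSplitSemisimple k C)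
    (D : LinearPivotalSubcategory k C) (hunit : IsSplitSimple k (𝟙_ D.Obj))
    (hD : IsSplitSemisimple k D.Obj) (hfin : Finite (SimpleClasses k D.Obj))
    (hdim : pivotalDim k D.Obj ≠ 0) :
    IsSplitSemisimple k (RelativeCenter D) := by
  have := hC.hasFiniteBiproducts
  have := hC.isIdempotentComplete
  have := hC.finite_hom
  exact isSplitSemisimple_of_isVonNeumannRegular
    (RelativeCenter.isVonNeumannRegular hC.isVonNeumannRegular hunit hD hfin hdim)
    fun A => RelativeCenter.finite_hom A A

theorem lemma4p5 {k : Type w} [Field k] [IsAlgClosed k] {C : Type u} [Category.{v} C]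
    [Preadditive C] [Linear k C] [MonoidalCategory C] [MonoidalPreadditive C]
    [MonoidalLinear k C] [PivotalCategory C] (hC : IsSplitSemisimple k C)
    (hunit : IsSplitSimple k (𝟙_ C)) (D : LinearPivotalSubcategory k C)
    (hD : IsSplitSemisimple k D.Obj) (hfin : Finite (SimpleClasses k D.Obj))
    (hdim : pivotalDim k D.Obj ≠ 0) :
    IsSplitSemisimple k (RelativeCenter D) :=
  lemma4p5_general hC D (LinearPivotalSubcategory.isSplitSimple_of_val hunit) hD hfin hdim
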